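/- Let $d\ge 1$, $\delta\in[0,1]$, $\eta\ge 0$, and for $n\ge 0$ let $\Lambda_n=[-n,n]^d\cap\mathbb{Z}^d$. Let $(\theta_u)_{u\in\Lambda_n}$ be i.i.d. uniform $\pm1$ random variables. For each (undirected) edge $\{u,v\}$ of the nearest-neighbour lattice with $u,v\in\Lambda_n$ one observes $Y^{\delta}_{uv}$, equal to $\theta_u\theta_v$ with probability $1-p$ and to $-\theta_u\theta_v$ with probability $p$, where $p=(1-\delta)/2$, independently over edges given $\theta$. For each unordered pair $u,v\in\Lambda_n$ one also observes $$Y^{\eta}_{uv}=\sqrt{\frac{\eta}{(2n+1)^d}}\,\theta_u\theta_v+Z_{uv},$$ where the $Z_{uv}\sim N(0,1)$ are independent of each other and of everything else. Let $Y_n$ denote the collection of all these observations and set $$\varphi_{n}(\delta,\eta)=\frac{1}{|\Lambda_n|^2}\sum_{u,v\in\Lambda_n}\mathbb{E}\Big[\mathbb{E}\big[\theta_u\theta_v\,\big|\,Y_n\big]^2\Big].$$ For $\delta\in[0,1]$ let $\mathcal{D}_\delta$ be the set of those $\eta\ge0$ for which $(\varphi_n(\delta,\eta))_n$ does not converge.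 Then $\mathcal{D}_\delta$ is countable for every $\delta\in[0,1]$. Moreover, writing the limit, for $\eta\in[0,\infty)\setminus\mathcal{D}_\delta$, as $$\lim_{n\to\infty}\varphi_n(\delta,\eta)=q_\star^2(\delta,\eta),\qquad q_\star(\delta,\eta)\ge 0,$$ the function $q_\star$ is non-decreasing in each variable where it is defined: for each $\eta\ge0$ the map $\delta\mapsto q_\star(\delta,\eta)$ is non-decreasing on $\{\delta\in[0,1]:\eta\notin\mathcal{D}_\delta\}$, and for each $\delta\in[0,1]$ the map $\eta\mapsto q_\star(\delta,\eta)$ is non-decreasing on $[0,\infty)\setminus\mathcal{D}_\delta$. -/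

import Mathlib

open MeasureTheory ProbabilityTheory Filter Topology

noncomputable section

namespace LatticeSync

/-- The box `Λ_n = [-n, n]^d ∩ ℤ^d`. -/
def box (d n : ℕ) : Finset (Fin d → ℤ) :=
  Finset.Icc (fun _ => -(n : ℤ)) (fun _ => (n : ℤ))

/-- The nearest-neighbour graph on the box: `u` and `v` are adjacent iff their Euclidean distance
is `1`. -/
def boxGraph (d n : ℕ) : SimpleGraph (box d n) where
  Adj u v := ∑ i, (u.1 i - v.1 i) ^ 2 = 1
  symm := ⟨fun u v h => by
    rw [← h]
    exact Finset.sum_congr rfl fun i _ => by ring⟩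
  loopless := ⟨fun u h => by simp at h⟩

/-- The set `E_n` of (undirected) lattice edges inside the box. -/
abbrev Edge (d n : ℕ) : Type := (boxGraph d n).edgeSet

instance instFintypeEdge (d n : ℕ) : Fintype (Edge d n) := Fintype.ofFinite _

/-- Sample space: the signs `θ_u` of the vertices, a flip sign for every lattice edge, and
the noise `Z_{uv}` for every unordered pair of vertices of the box. -/
abbrev Sample (d n : ℕ) : Type :=
  (box d n → ℤˣ) × (Edge d n → ℤˣ) × (Sym2 (box d n) → ℝ)

instance instMeasurableSingletonClassSign : MeasurableSingletonClass ℤˣ where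
  measurableSet_singleton a :=
    ⟨{(a : ℤ)}, measurableSet_singleton _, by ext b; simp [Units.ext_iff]⟩

/-- The sign that is `-1` with probability `p` and `+1` with probability `1 - p`. -/
def signLaw (p : ℝ) : Measure ℤˣ :=
  ENNReal.ofReal (1 - p) • Measure.dirac 1 + ENNReal.ofReal p • Measure.dirac (-1)

/-- The law of all the randomness: i.i.d. symmetric signs on the vertices, i.i.d. flips of
probability `p = (1 - δ) / 2` on the edges, i.i.d. standard Gaussians on the unordered pairs, the
three families being independent. -/
def law (d n : ℕ) (δ : ℝ) : Measure (Sample d n) :=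
  (Measure.pi fun _ => signLaw (1 / 2)).prod
    ((Measure.pi fun _ => signLaw ((1 - δ) / 2)).prod
      (Measure.pi fun _ => gaussianReal 0 1))

/-- The product `θ_u θ_v` of the signs at the ends of an unordered pair `{u, v}`. -/
def pairSign {V : Type*} (θ : V → ℤˣ) (e : Sym2 V) : ℤˣ :=
  Sym2.lift ⟨fun u v => θ u * θ v, fun u v => mul_comm (θ u) (θ v)⟩ e

/-- All the observations in the box: `± θ_u θ_v` for every lattice edge, and
`√(η / (2n+1)^d) θ_u θ_v + Z_{uv}` for every unordered pair. -/
def obs (d n : ℕ) (η : ℝ) (ω : Sample d n) : (Edge d n → ℤˣ) × (Sym2 (box d n) → ℝ) :=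
  (fun e => ω.2.1 e * pairSign ω.1 e.1,
   fun e => √(η / (2 * (n : ℝ) + 1) ^ d) * ((pairSign ω.1 e : ℤ) : ℝ) + ω.2.2 e)

/-- The sigma-algebra generated by the observations. -/
abbrev obsSigma (d n : ℕ) (η : ℝ) : MeasurableSpace (Sample d n) :=
  MeasurableSpace.comap (obs d n η) inferInstance

/-- The Bayes estimator `E[θ_u θ_v | Y]`. -/
def posteriorCorr (d n : ℕ) (δ η : ℝ) (u v : box d n) : Sample d n → ℝ :=
  (law d n δ)[fun ω => ((ω.1 u : ℤ) : ℝ) * ((ω.1 v : ℤ) : ℝ) | obsSigma d n η]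

/-- The average squared posterior pair correlation
`φ_{Λ_n} = |Λ_n|⁻² ∑_{u, v ∈ Λ_n} E[ E[θ_u θ_v | Y]² ]`. -/
def pairCorr (d n : ℕ) (δ η : ℝ) : ℝ :=
  (1 / ((box d n).card : ℝ) ^ 2) *
    ∑ u : box d n, ∑ v : box d n, ∫ ω, (posteriorCorr d n δ η u v ω) ^ 2 ∂(law d n δ)

/-- The set `D_δ` of those `η ≥ 0` for which `(φ_{Λ_n})_n` has no limit. -/
def badSNR (d : ℕ) (δ : ℝ) : Set ℝ :=
  {η | 0 ≤ η ∧ ¬ ∃ l : ℝ, Tendsto (fun n => pairCorr d n δ η) atTop (𝓝 l)}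

theorem isProbabilityMeasure_signLaw {p : ℝ} (hp : p ∈ Set.Icc (0 : ℝ) 1) :
    IsProbabilityMeasure (signLaw p) := by
  refine ⟨?_⟩
  have h0 : 0 ≤ 1 - p := by linarith [hp.2]
  simp [signLaw, ← ENNReal.ofReal_add h0 hp.1]

/-- For `δ ∈ [-1, 1]` the model is a probability measure. -/
theorem isProbabilityMeasure_law (d n : ℕ) {δ : ℝ} (hδ : δ ∈ Set.Icc (-1 : ℝ) 1) :
    IsProbabilityMeasure (law d n δ) := by
  have h1 : IsProbabilityMeasure (signLaw (1 / 2)) :=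
    isProbabilityMeasure_signLaw ⟨by norm_num, by norm_num⟩
  have h2 : IsProbabilityMeasure (signLaw ((1 - δ) / 2)) :=
    isProbabilityMeasure_signLaw ⟨by linarith [hδ.2], by linarith [hδ.1]⟩
  unfold law
  infer_instance

/-- The observations are measurable, so the conditional expectation above is the genuine one. -/
theorem measurable_obs (d n : ℕ) (η : ℝ) : Measurable (obs d n η) := by
  have hp : ∀ e : Sym2 (box d n), Measurable fun ω : Sample d n => pairSign ω.1 e := by
    intro e
    exact (measurable_of_countable fun θ : box d n → ℤˣ => pairSign θ e).comp measurable_fst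
  refine Measurable.prodMk (measurable_pi_lambda _ fun e => ?_) (measurable_pi_lambda _ fun e => ?_)
  · have h1 : Measurable fun ω : Sample d n => ω.2.1 e :=
      (measurable_pi_apply e).comp (measurable_fst.comp measurable_snd)
    exact (measurable_of_countable fun q : ℤˣ × ℤˣ => q.1 * q.2).comp (h1.prodMk (hp e.1))
  · have h2 : Measurable fun ω : Sample d n => ω.2.2 e :=
      (measurable_pi_apply e).comp (measurable_snd.comp measurable_snd)
    have h3 : Measurable fun ω : Sample d n => ((pairSign ω.1 e : ℤ) : ℝ) :=
      (measurable_of_countable fun s : ℤˣ => ((s : ℤ) : ℝ)).comp (hp e)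
    exact (h3.const_mul _).add h2

theorem obsSigma_le (d n : ℕ) (η : ℝ) :
    obsSigma d n η ≤ (inferInstance : MeasurableSpace (Sample d n)) :=
  (measurable_obs d n η).comap_le

end LatticeSync

end

noncomputable section

namespace LatticeSync

set_option linter.unusedSectionVars false

/-! By Bayes' formula the posterior of the spins given `Y` is a Gibbs measure with weights `lik`.
Its mean log-partition function `freeEnergy`, taken per site, has derivative `(φ_n + 1/|Λ_n|)/4` in
`η` (`hasDerivAt_freeEnergy_amp`). So `φ_n` is, up to a vanishing term, the derivative of a function
of `η`, and three facts suffice.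

Monotonicity: data with smaller `δ` or `η` can be simulated from data with larger parameters by
adding independent noise, and a Bayes estimator based on noisier data has smaller second moment
(`overlap_degrade_le`). Hence `φ_n` is non-decreasing in each variable, and the free energy is
convex in `η`.

Convergence of the free energy density: cutting a region into two pieces removes the lattice edges
between them, at a cost of at most `log 2` each (`freeEnergy_le_of_drop`), and replaces the
mean-field coupling at scale `|S ∪ T|` by separate couplings at scales `|S|` and `|T|`.
Interpolating between the two couplings shows that the second change can only raise the free energy
(`freeEnergy_le_split`), because the relevant quadratic form is minus a square. After subtracting
`log 2` per edge the free energy is therefore subadditive and translation invariant, and it has a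
density along boxes (`exists_tendsto_box_of_subadditive`).

Convex analysis: if convex functions converge pointwise, their derivatives converge off a countable
set (`countable_not_tendsto_deriv`).

The derivative formula is obtained without Gaussian integration by parts. The model amplitudes and
the amplitudes generating the data are varied separately (`crossEnergy`). The true model maximizes
the mean log-likelihood, so the derivative in the model amplitudes vanishes on the diagonal and only
the data direction contributes (`hasFDerivAt_freeEnergy`). -/

/-! ### Product measures -/

/-- A product of measures with densities is the product measure with the product density. -/
theorem pi_withDensity {ι : Type*} [Fintype ι] {X : ι → Type*} [∀ i, MeasurableSpace (X i)]
    (μ : ∀ i, Measure (X i)) [∀ i, IsProbabilityMeasure (μ i)]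
    (f : ∀ i, X i → ENNReal) (hf : ∀ i, Measurable (f i))
    [∀ i, SigmaFinite ((μ i).withDensity (f i))] :
    Measure.pi (fun i => (μ i).withDensity (f i)) =
      (Measure.pi μ).withDensity (fun x => ∏ i, f i (x i)) := by
  refine Measure.pi_eq fun s hs => ?_
  rw [withDensity_apply _ (MeasurableSet.univ_pi hs), ← lintegral_indicator
    (MeasurableSet.univ_pi hs)]
  have h1 : ∀ x : ∀ i, X i, (Set.univ.pi s).indicator (fun x => ∏ i, f i (x i)) x =
      ∏ i, (s i).indicator (f i) (x i) := by
    intro x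
    by_cases hx : x ∈ Set.univ.pi s
    · rw [Set.indicator_of_mem hx]
      exact Finset.prod_congr rfl fun i _ => (Set.indicator_of_mem (hx i trivial) _).symm
    · rw [Set.indicator_of_notMem hx]
      simp only [Set.mem_pi, Set.mem_univ, true_implies, not_forall] at hx
      obtain ⟨i, hi⟩ := hx
      exact (Finset.prod_eq_zero (Finset.mem_univ i) (Set.indicator_of_notMem hi _)).symm
  simp_rw [h1]
  have hm : ∀ i, Measurable ((s i).indicator (f i)) := fun i => (hf i).indicator (hs i)
  -- Coordinates are independent under the product measure, so the integral of the product of the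
  -- truncated densities is the product of their integrals.
  have hind := iIndepFun_pi (μ := μ) (X := fun i => (s i).indicator (f i))
    fun i => (hm i).aemeasurable
  rw [lintegral_prod_eq_prod_lintegral_of_indepFun Finset.univ _ hind
    fun i => (hm i).comp (measurable_pi_apply i)]
  refine Finset.prod_congr rfl fun i _ => ?_
  rw [withDensity_apply _ (hs i), ← lintegral_indicator (hs i)]
  exact (measurePreserving_eval μ i).lintegral_comp (hm i)

/-- Restricting an i.i.d. family along an injection gives an i.i.d. family. -/
theorem pi_map_comp_injective {ι κ X : Type*} [Fintype ι] [Fintype κ] [MeasurableSpace X]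
    (μ : Measure X) [IsProbabilityMeasure μ] {g : κ → ι} (hg : Function.Injective g) :
    (Measure.pi fun _ : ι => μ).map (fun x => x ∘ g) = Measure.pi fun _ : κ => μ := by
  have hind := iIndepFun_pi (μ := fun _ : ι => μ) (X := fun _ => id) fun i => aemeasurable_id
  have h2 := (hind.precomp hg).map_fun_eq_pi_map
    fun i => (measurable_pi_apply (g i)).aemeasurable
  have h3 : ∀ i : κ, (Measure.pi fun _ : ι => μ).map (fun x => x (g i)) = μ := fun i =>
    (measurePreserving_eval (fun _ : ι => μ) (g i)).map_eq
  refine h2.trans ?_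
  congr 1
  funext i
  exact h3 i

/-- Combining two i.i.d. families coordinate by coordinate. -/
theorem pi_prod_map_pi {ι X Y Z : Type*} [Fintype ι] [MeasurableSpace X] [MeasurableSpace Y]
    [MeasurableSpace Z] (μ : Measure X) (ν : Measure Y) [IsProbabilityMeasure μ]
    [IsProbabilityMeasure ν] {f : X × Y → Z} (hf : Measurable f) :
    ((Measure.pi fun _ : ι => μ).prod (Measure.pi fun _ : ι => ν)).map
      (fun p i => f (p.1 i, p.2 i)) = Measure.pi fun _ : ι => (μ.prod ν).map f := by
  have h := (measurePreserving_arrowProdEquivProdArrow X Y ι (fun _ => μ) (fun _ => ν)).map_eq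
  have : IsProbabilityMeasure ((μ.prod ν).map f) :=
    Measure.isProbabilityMeasure_map hf.aemeasurable
  rw [← h, Measure.map_map _ (MeasurableEquiv.measurable _),
    ← Measure.pi_map_pi (f := fun _ => f) (fun _ => hf.aemeasurable)]
  · rfl
  · refine measurable_pi_lambda _ fun i => hf.comp ?_
    fun_prop

/-! ### The general model -/

variable {V A : Type*} [Fintype V] [DecidableEq V] [Fintype A]

/-- The randomness of a synchronization problem with vertex set `V` and discrete observations
indexed by `A`. -/
abbrev Draw (V A : Type*) : Type _ := (V → ℤˣ) × (A → ℤˣ) × (Sym2 V → ℝ)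

/-- The observations of a synchronization problem. -/
abbrev Obs (V A : Type*) : Type _ := (A → ℤˣ) × (Sym2 V → ℝ)

/-- The law of the flips and of the Gaussian noise. -/
def noiseLaw (V A : Type*) [Fintype V] [DecidableEq V] [Fintype A] (δ : ℝ) :
    Measure (Obs V A) :=
  (Measure.pi fun _ => signLaw ((1 - δ) / 2)).prod (Measure.pi fun _ => gaussianReal 0 1)

/-- The uniform law on the spin configurations. -/
def spinLaw (V : Type*) [Fintype V] : Measure (V → ℤˣ) := Measure.pi fun _ => signLaw (1 / 2)

/-- The law of all the randomness. -/
def drawLaw (V A : Type*) [Fintype V] [DecidableEq V] [Fintype A] (δ : ℝ) : Measure (Draw V A) :=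
  (spinLaw V).prod (noiseLaw V A δ)

/-- The value `σ_u σ_v` as a real number. -/
def sgn (σ : V → ℤˣ) (e : Sym2 V) : ℝ := ((pairSign σ e : ℤ) : ℝ)

/-- The observations: flipped pair signs at the pairs `c e`, and Gaussian observations of all the
pair signs with amplitudes `a`. -/
def observe (c : A → Sym2 V) (a : Sym2 V → ℝ) (ω : Draw V A) : Obs V A :=
  (fun e => ω.2.1 e * pairSign ω.1 (c e), fun e => a e * sgn ω.1 e + ω.2.2 e)

/-- The likelihood ratio of the discrete observations. -/
def wt (c : A → Sym2 V) (δ : ℝ) (σ : V → ℤˣ) (k : A → ℤˣ) : ℝ :=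
  ∏ e, (1 + δ * (((k e * pairSign σ (c e) : ℤˣ) : ℤ) : ℝ))

/-- The log-likelihood ratio of the Gaussian observations. -/
def expo (a : Sym2 V → ℝ) (σ : V → ℤˣ) (z : Sym2 V → ℝ) : ℝ :=
  ∑ e, (a e * sgn σ e * z e - a e ^ 2 / 2)

/-- The likelihood ratio of all the observations. -/
def lik (c : A → Sym2 V) (δ : ℝ) (a : Sym2 V → ℝ) (σ : V → ℤˣ) (y : Obs V A) : ℝ :=
  wt c δ σ y.1 * Real.exp (expo a σ y.2)

omit [Fintype V] [DecidableEq V] in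
theorem sgn_eq_or (σ : V → ℤˣ) (e : Sym2 V) : sgn σ e = 1 ∨ sgn σ e = -1 := by
  unfold sgn
  rcases Int.units_eq_one_or (pairSign σ e) with h | h <;> simp [h]

omit [Fintype V] [DecidableEq V] in
theorem sgn_sq (σ : V → ℤˣ) (e : Sym2 V) : sgn σ e ^ 2 = 1 := by
  rcases sgn_eq_or σ e with h | h <;> simp [h]

omit [Fintype V] [DecidableEq V] in
theorem abs_sgn (σ : V → ℤˣ) (e : Sym2 V) : |sgn σ e| = 1 := by
  rcases sgn_eq_or σ e with h | h <;> simp [h]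

instance isProbabilityMeasure_signLaw_half : IsProbabilityMeasure (signLaw (1 / 2)) :=
  isProbabilityMeasure_signLaw ⟨by norm_num, by norm_num⟩

instance : IsProbabilityMeasure (spinLaw V) := by unfold spinLaw; infer_instance

theorem isProbabilityMeasure_flip {δ : ℝ} (hδ : δ ∈ Set.Icc (-1 : ℝ) 1) :
    IsProbabilityMeasure (signLaw ((1 - δ) / 2)) :=
  isProbabilityMeasure_signLaw ⟨by linarith [hδ.2], by linarith [hδ.1]⟩

theorem isProbabilityMeasure_noiseLaw {δ : ℝ} (hδ : δ ∈ Set.Icc (-1 : ℝ) 1) :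
    IsProbabilityMeasure (noiseLaw V A δ) := by
  have := isProbabilityMeasure_flip hδ
  unfold noiseLaw
  infer_instance

theorem isProbabilityMeasure_drawLaw {δ : ℝ} (hδ : δ ∈ Set.Icc (-1 : ℝ) 1) :
    IsProbabilityMeasure (drawLaw V A δ) := by
  have := isProbabilityMeasure_noiseLaw (V := V) (A := A) hδ
  unfold drawLaw
  infer_instance

theorem wt_nonneg (c : A → Sym2 V) {δ : ℝ} (hδ : δ ∈ Set.Icc (-1 : ℝ) 1) (σ : V → ℤˣ)
    (k : A → ℤˣ) : 0 ≤ wt c δ σ k := by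
  refine Finset.prod_nonneg fun e _ => ?_
  rcases Int.units_eq_one_or (k e * pairSign σ (c e)) with h | h <;> rw [h] <;> push_cast <;>
    linarith [hδ.1, hδ.2]

theorem lik_nonneg (c : A → Sym2 V) {δ : ℝ} (hδ : δ ∈ Set.Icc (-1 : ℝ) 1) (a : Sym2 V → ℝ)
    (σ : V → ℤˣ) (y : Obs V A) : 0 ≤ lik c δ a σ y :=
  mul_nonneg (wt_nonneg c hδ _ _) (Real.exp_pos _).le

@[fun_prop]
theorem measurable_units_val : Measurable fun s : ℤˣ => ((s : ℤ) : ℝ) :=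
  measurable_of_countable _

@[fun_prop]
theorem measurable_units_mul : Measurable fun q : ℤˣ × ℤˣ => q.1 * q.2 :=
  measurable_of_countable _

theorem measurable_uncurry_of_finite {S T U : Type*} [Finite S] [MeasurableSpace S]
    [MeasurableSingletonClass S] [MeasurableSpace T] [MeasurableSpace U] {f : S → T → U}
    (hf : ∀ s, Measurable (f s)) : Measurable fun p : S × T => f p.1 p.2 :=
  measurable_from_prod_countable_right hf

theorem measurable_expo (a : Sym2 V → ℝ) (σ : V → ℤˣ) : Measurable (expo a σ) := by
  unfold expo
  fun_prop

theorem measurable_lik (c : A → Sym2 V) (δ : ℝ) (a : Sym2 V → ℝ) (σ : V → ℤˣ) :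
    Measurable (lik c δ a σ) := by
  have h1 : Measurable (wt c δ σ) := measurable_of_countable _
  exact (h1.comp measurable_fst).mul ((measurable_expo a σ).comp measurable_snd).exp

theorem measurable_lik_uncurry (c : A → Sym2 V) (δ : ℝ) (a : Sym2 V → ℝ) :
    Measurable fun p : (V → ℤˣ) × Obs V A => lik c δ a p.1 p.2 :=
  measurable_uncurry_of_finite fun σ => measurable_lik c δ a σ

theorem measurable_observe (c : A → Sym2 V) (a : Sym2 V → ℝ) : Measurable (observe c a) := by
  have h : ∀ e : Sym2 V, Measurable fun σ : V → ℤˣ => pairSign σ e :=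
    fun e => measurable_of_countable _
  refine Measurable.prodMk (measurable_pi_lambda _ fun e => ?_) (measurable_pi_lambda _ fun e => ?_)
  · have h1 : Measurable fun ω : Draw V A => ω.2.1 e :=
      (measurable_pi_apply e).comp measurable_snd.fst
    exact measurable_units_mul.comp (h1.prodMk ((h (c e)).comp measurable_fst))
  · have h1 : Measurable fun ω : Draw V A => ω.2.2 e :=
      (measurable_pi_apply e).comp measurable_snd.snd
    exact ((measurable_units_val.comp ((h e).comp measurable_fst)).const_mul _).add h1

/-! ### Change of measure -/

/-- Flip probability `(1 - δ)/2` gives the sign `s` mass `(1 + δ s)/2`, and `t` is its own inverse.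
The reference law is the fair sign, that is `δ = 0`. -/
theorem signLaw_map_mul (δ : ℝ) (t : ℤˣ) :
    (signLaw ((1 - δ) / 2)).map (fun k => k * t) =
      (signLaw (1 / 2)).withDensity
        (fun k => ENNReal.ofReal (1 + δ * (((k * t : ℤˣ) : ℤ) : ℝ))) := by
  have hm : Measurable fun k : ℤˣ => k * t := measurable_of_countable _
  ext s hs
  rw [withDensity_apply _ hs, Measure.map_apply hm hs, ← lintegral_indicator hs]
  have h1 : ENNReal.ofReal (1 / 2) * ENNReal.ofReal (1 + δ) = ENNReal.ofReal (1 - (1 - δ) / 2) := by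
    rw [← ENNReal.ofReal_mul (by norm_num)]; congr 1; ring
  have h2 : ENNReal.ofReal (1 / 2) * ENNReal.ofReal (1 - δ) = ENNReal.ofReal ((1 - δ) / 2) := by
    rw [← ENNReal.ofReal_mul (by norm_num)]; congr 1; ring
  have e1 : (1 : ℝ) - 1 / 2 = 1 / 2 := by norm_num
  simp only [signLaw, e1, lintegral_add_measure, lintegral_smul_measure, lintegral_dirac,
    Measure.add_apply, Measure.smul_apply, Measure.dirac_apply, smul_eq_mul]
  rw [← h1, ← h2]
  rcases Int.units_eq_one_or t with rfl | rfl
  · simp only [mul_one]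
    by_cases ha : (1 : ℤˣ) ∈ s <;> by_cases hb : (-1 : ℤˣ) ∈ s <;> simp [ha, hb, ← sub_eq_add_neg]
  · push_cast
    by_cases ha : (1 : ℤˣ) ∈ s <;> by_cases hb : (-1 : ℤˣ) ∈ s <;>
      simp [ha, hb, ← sub_eq_add_neg]
    exact add_comm _ _

theorem gaussianReal_eq_withDensity (m : ℝ) :
    gaussianReal m 1 = (gaussianReal 0 1).withDensity
      (fun x => ENNReal.ofReal (Real.exp (m * x - m ^ 2 / 2))) := by
  rw [gaussianReal_of_var_ne_zero _ one_ne_zero, gaussianReal_of_var_ne_zero _ one_ne_zero,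
    ← withDensity_mul _ (measurable_gaussianPDF _ _) (by fun_prop)]
  congr 1
  funext x
  rw [Pi.mul_apply, gaussianPDF, gaussianPDF, ← ENNReal.ofReal_mul (gaussianPDFReal_nonneg _ _ _)]
  congr 1
  rw [gaussianPDFReal, gaussianPDFReal, mul_assoc _ (Real.exp _), ← Real.exp_add]
  congr 2
  simp only [NNReal.coe_one]
  ring

/-- For fixed spins the observations are independent, so the one-coordinate densities multiply. The
reference measure, pure noise at `δ = 0`, depends neither on the spins nor on the parameters. -/
theorem noiseLaw_map_observe (c : A → Sym2 V) {δ : ℝ} (hδ : δ ∈ Set.Icc (-1 : ℝ) 1)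
    (a : Sym2 V → ℝ) (θ : V → ℤˣ) :
    (noiseLaw V A δ).map (fun w => observe c a (θ, w)) =
      (noiseLaw V A 0).withDensity (fun y => ENNReal.ofReal (lik c δ a θ y)) := by
  have := isProbabilityMeasure_flip hδ
  have e0 : ((1 : ℝ) - 0) / 2 = 1 / 2 := by norm_num
  have hm1 : ∀ e, Measurable fun k : ℤˣ => k * pairSign θ (c e) :=
    fun e => measurable_of_countable _
  have hp1 : ∀ e, IsProbabilityMeasure
      ((signLaw ((1 - δ) / 2)).map fun k => k * pairSign θ (c e)) :=
    fun e => Measure.isProbabilityMeasure_map (hm1 e).aemeasurable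
  have hm2 : ∀ e, Measurable fun x : ℝ => a e * sgn θ e + x := fun e => by fun_prop
  have hp2 : ∀ e, IsProbabilityMeasure
      ((gaussianReal 0 1).map fun x : ℝ => a e * sgn θ e + x) :=
    fun e => Measure.isProbabilityMeasure_map (hm2 e).aemeasurable
  have h1 : (Measure.pi fun _ : A => signLaw ((1 - δ) / 2)).map
        (fun k e => k e * pairSign θ (c e)) =
      (Measure.pi fun _ : A => signLaw (1 / 2)).withDensity
        (fun k => ENNReal.ofReal (wt c δ θ k)) := by
    rw [Measure.pi_map_pi (f := fun e k => k * pairSign θ (c e))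
      (fun e => (hm1 e).aemeasurable)]
    have hs : ∀ e, SigmaFinite ((signLaw (1 / 2)).withDensity fun k : ℤˣ =>
        ENNReal.ofReal (1 + δ * (((k * pairSign θ (c e) : ℤˣ) : ℤ) : ℝ))) := fun e => by
      rw [← signLaw_map_mul δ]; have := hp1 e; infer_instance
    simp_rw [signLaw_map_mul δ]
    rw [pi_withDensity _ _ fun e => measurable_of_countable _]
    congr 1
    funext k
    rw [wt, ENNReal.ofReal_prod_of_nonneg]
    intro e _
    rcases Int.units_eq_one_or (k e * pairSign θ (c e)) with h | h <;> rw [h] <;> push_cast <;>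
      linarith [hδ.1, hδ.2]
  have h2 : (Measure.pi fun _ : Sym2 V => gaussianReal 0 1).map
        (fun z e => a e * sgn θ e + z e) =
      (Measure.pi fun _ : Sym2 V => gaussianReal 0 1).withDensity
        (fun z => ENNReal.ofReal (Real.exp (expo a θ z))) := by
    rw [Measure.pi_map_pi (f := fun e z => a e * sgn θ e + z) (fun e => (hm2 e).aemeasurable)]
    have hg : ∀ e, (gaussianReal 0 1).map (fun x : ℝ => a e * sgn θ e + x) =
        (gaussianReal 0 1).withDensity
          (fun x => ENNReal.ofReal (Real.exp (a e * sgn θ e * x - (a e * sgn θ e) ^ 2 / 2))) := by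
      intro e
      rw [gaussianReal_map_const_add, zero_add, gaussianReal_eq_withDensity]
    have hs : ∀ e, SigmaFinite ((gaussianReal 0 1).withDensity fun x : ℝ =>
        ENNReal.ofReal (Real.exp (a e * sgn θ e * x - (a e * sgn θ e) ^ 2 / 2))) := fun e => by
      rw [← hg]; have := hp2 e; infer_instance
    simp_rw [hg]
    rw [pi_withDensity _ _ fun e => by fun_prop]
    congr 1
    funext z
    rw [← ENNReal.ofReal_prod_of_nonneg fun e _ => (Real.exp_pos _).le, ← Real.exp_sum]
    congr 3
    funext e
    -- The spins drop out of the quadratic term since their signs square to one; this is why `expo`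
    -- contains `a e ^ 2 / 2`.
    rw [mul_pow, sgn_sq, mul_one]
  have hw : Measurable fun k => ENNReal.ofReal (wt c δ θ k) := measurable_of_countable _
  have he : Measurable fun z => ENNReal.ofReal (Real.exp (expo a θ z)) :=
    (measurable_expo a θ).exp.ennreal_ofReal
  have hmm1 : Measurable fun (k : A → ℤˣ) e => k e * pairSign θ (c e) := measurable_of_countable _
  have hmm2 : Measurable fun (z : Sym2 V → ℝ) e => a e * sgn θ e + z e := by fun_prop
  have hmap := Measure.map_prod_map (Measure.pi fun _ : A => signLaw ((1 - δ) / 2))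
    (Measure.pi fun _ : Sym2 V => gaussianReal 0 1) hmm1 hmm2
  have hS1 : SFinite ((Measure.pi fun _ : A => signLaw (1 / 2)).withDensity
        (fun k => ENNReal.ofReal (wt c δ θ k))) := by rw [← h1]; infer_instance
  have hS2 : SFinite ((Measure.pi fun _ : Sym2 V => gaussianReal 0 1).withDensity
        (fun z => ENNReal.ofReal (Real.exp (expo a θ z)))) := by rw [← h2]; infer_instance
  rw [h1, h2, prod_withDensity hw he] at hmap
  unfold noiseLaw
  rw [e0]
  refine hmap.symm.trans ?_
  congr 1
  funext y
  rw [lik, ENNReal.ofReal_mul (wt_nonneg c hδ _ _)]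

/-- Bayes' formula: spins and data have joint density `lik` with respect to independent uniform
spins and pure noise. This is what identifies `gibbs` with the posterior mean. -/
theorem drawLaw_map_observe (c : A → Sym2 V) {δ : ℝ} (hδ : δ ∈ Set.Icc (-1 : ℝ) 1)
    (a : Sym2 V → ℝ) :
    (drawLaw V A δ).map (fun ω => (ω.1, observe c a ω)) =
      ((spinLaw V).prod (noiseLaw V A 0)).withDensity
        (fun p => ENNReal.ofReal (lik c δ a p.1 p.2)) := by
  have := isProbabilityMeasure_noiseLaw (V := V) (A := A) hδ
  have := isProbabilityMeasure_noiseLaw (V := V) (A := A) (δ := 0) ⟨by norm_num, by norm_num⟩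
  have hobs := measurable_observe c a
  have hm : Measurable fun ω : Draw V A => (ω.1, observe c a ω) := measurable_fst.prodMk hobs
  have hl := (measurable_lik_uncurry c δ a).ennreal_ofReal
  ext s hs
  rw [Measure.map_apply hm hs, withDensity_apply _ hs, drawLaw, Measure.prod_apply (hm hs),
    ← lintegral_indicator hs, lintegral_prod _ (hl.indicator hs).aemeasurable]
  refine lintegral_congr fun θ => ?_
  have hmθ : Measurable fun w : Obs V A => observe c a (θ, w) := hobs.comp measurable_prodMk_left
  have hsθ : MeasurableSet (Prod.mk θ ⁻¹' s) := measurable_prodMk_left hs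
  have h1 := congrArg (fun μ => μ (Prod.mk θ ⁻¹' s)) (noiseLaw_map_observe c hδ a θ)
  simp only [Measure.map_apply hmθ hsθ] at h1
  rw [withDensity_apply _ hsθ, ← lintegral_indicator hsθ] at h1
  exact h1

/-! ### Partition function and Gibbs averages -/

/-- The partition function: the sum of the likelihood ratios over all spin configurations. -/
def partition (c : A → Sym2 V) (δ : ℝ) (a : Sym2 V → ℝ) (y : Obs V A) : ℝ :=
  ∑ σ, lik c δ a σ y

/-- The posterior mean of `f`. -/
def gibbs (c : A → Sym2 V) (δ : ℝ) (a : Sym2 V → ℝ) (f : (V → ℤˣ) → ℝ) (y : Obs V A) : ℝ :=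
  (∑ σ, lik c δ a σ y * f σ) / partition c δ a y

theorem partition_nonneg (c : A → Sym2 V) {δ : ℝ} (hδ : δ ∈ Set.Icc (-1 : ℝ) 1)
    (a : Sym2 V → ℝ) (y : Obs V A) : 0 ≤ partition c δ a y :=
  Finset.sum_nonneg fun σ _ => lik_nonneg c hδ a σ y

theorem measurable_partition (c : A → Sym2 V) (δ : ℝ) (a : Sym2 V → ℝ) :
    Measurable (partition c δ a) :=
  Finset.measurable_fun_sum _ fun σ _ => measurable_lik c δ a σ

theorem measurable_gibbs (c : A → Sym2 V) (δ : ℝ) (a : Sym2 V → ℝ) (f : (V → ℤˣ) → ℝ) :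
    Measurable (gibbs c δ a f) :=
  (Finset.measurable_fun_sum _ fun σ _ => (measurable_lik c δ a σ).mul_const _).div
    (measurable_partition c δ a)

/-- At `δ = ±1` the partition function can vanish. The identity survives because nonnegative terms
with zero sum all vanish, whatever value division by zero returns. -/
theorem partition_mul_gibbs (c : A → Sym2 V) {δ : ℝ} (hδ : δ ∈ Set.Icc (-1 : ℝ) 1)
    (a : Sym2 V → ℝ) (f : (V → ℤˣ) → ℝ) (y : Obs V A) :
    partition c δ a y * gibbs c δ a f y = ∑ σ, lik c δ a σ y * f σ := by
  by_cases h : partition c δ a y = 0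
  · have h0 := (Finset.sum_eq_zero_iff_of_nonneg fun σ _ => lik_nonneg c hδ a σ y).1 h
    rw [h, zero_mul]
    exact (Finset.sum_eq_zero fun σ hσ => by rw [h0 σ hσ, zero_mul]).symm
  · rw [gibbs, mul_div_cancel₀ _ h]

theorem abs_gibbs_le (c : A → Sym2 V) {δ : ℝ} (hδ : δ ∈ Set.Icc (-1 : ℝ) 1)
    (a : Sym2 V → ℝ) {f : (V → ℤˣ) → ℝ} {M : ℝ} (hM : 0 ≤ M) (hf : ∀ σ, |f σ| ≤ M)
    (y : Obs V A) : |gibbs c δ a f y| ≤ M := by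
  rw [gibbs, abs_div, abs_of_nonneg (partition_nonneg c hδ a y)]
  refine div_le_of_le_mul₀ (partition_nonneg c hδ a y) hM ?_
  rw [partition, Finset.mul_sum]
  refine (Finset.abs_sum_le_sum_abs _ _).trans (Finset.sum_le_sum fun σ _ => ?_)
  rw [abs_mul, abs_of_nonneg (lik_nonneg c hδ a σ y), mul_comm]
  exact mul_le_mul_of_nonneg_right (hf σ) (lik_nonneg c hδ a σ y)

/-! ### Integration against the law of the model -/

theorem integral_spinLaw (f : (V → ℤˣ) → ℝ) :
    ∫ θ, f θ ∂spinLaw V = (1 / 2 : ℝ) ^ Fintype.card V * ∑ θ, f θ := by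
  rw [integral_fintype (Integrable.of_finite), Finset.mul_sum]
  refine Finset.sum_congr rfl fun θ _ => ?_
  have h1 : ∀ s : ℤˣ, signLaw (1 / 2) {s} = ENNReal.ofReal (1 / 2) := by
    intro s
    have e1 : (1 : ℝ) - 1 / 2 = 1 / 2 := by norm_num
    rcases Int.units_eq_one_or s with rfl | rfl <;> simp [signLaw, e1, -one_div]
  have h : (spinLaw V).real {θ} = (1 / 2 : ℝ) ^ Fintype.card V := by
    rw [Measure.real, spinLaw, Measure.pi_singleton]
    simp_rw [h1]
    simp
  rw [h, smul_eq_mul]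

/-- Every expectation in the model is transported to the fixed reference noise; the prefactor is the
uniform prior weight of one configuration. -/
theorem integral_drawLaw_observe (c : A → Sym2 V) {δ : ℝ} (hδ : δ ∈ Set.Icc (-1 : ℝ) 1)
    (a : Sym2 V → ℝ) {F : (V → ℤˣ) × Obs V A → ℝ} (hF : Measurable F)
    (hi : Integrable (fun ω => F (ω.1, observe c a ω)) (drawLaw V A δ)) :
    Integrable (fun y => ∑ θ, lik c δ a θ y * F (θ, y)) (noiseLaw V A 0) ∧
    ∫ ω, F (ω.1, observe c a ω) ∂drawLaw V A δ =
      (1 / 2 : ℝ) ^ Fintype.card V * ∫ y, ∑ θ, lik c δ a θ y * F (θ, y) ∂noiseLaw V A 0 := by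
  have := isProbabilityMeasure_noiseLaw (V := V) (A := A) (δ := 0) ⟨by norm_num, by norm_num⟩
  have hm : Measurable fun ω : Draw V A => (ω.1, observe c a ω) :=
    measurable_fst.prodMk (measurable_observe c a)
  have hl := measurable_lik_uncurry c δ a
  have hi2 : Integrable F ((drawLaw V A δ).map fun ω => (ω.1, observe c a ω)) :=
    (integrable_map_measure hF.aestronglyMeasurable hm.aemeasurable).2 hi
  rw [← integral_map hm.aemeasurable hF.aestronglyMeasurable, drawLaw_map_observe c hδ]
  rw [drawLaw_map_observe c hδ, integrable_withDensity_iff_integrable_smul' hl.ennreal_ofReal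
    (ae_of_all _ fun _ => ENNReal.ofReal_lt_top)] at hi2
  rw [integral_withDensity_eq_integral_toReal_smul hl.ennreal_ofReal
    (ae_of_all _ fun _ => ENNReal.ofReal_lt_top)]
  simp only [ENNReal.toReal_ofReal (lik_nonneg c hδ a _ _), smul_eq_mul] at hi2 ⊢
  have h1 := hi2.integral_prod_right
  have h2 := integral_prod_symm _ hi2
  simp only [integral_spinLaw] at h1 h2
  rw [integral_const_mul] at h2
  refine ⟨?_, h2⟩
  have h3 := h1.const_mul (((1 / 2 : ℝ) ^ Fintype.card V)⁻¹)
  refine h3.congr (ae_of_all _ fun y => ?_)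
  simp only
  rw [inv_mul_cancel_left₀ (by positivity)]

/-- Conditional averages under the posterior. -/
theorem integral_mul_eq_integral_gibbs_mul (c : A → Sym2 V) {δ : ℝ}
    (hδ : δ ∈ Set.Icc (-1 : ℝ) 1) (a : Sym2 V → ℝ) (f : (V → ℤˣ) → ℝ) {g : Obs V A → ℝ}
    (hg : Measurable g) {M : ℝ} (hM : ∀ y, |g y| ≤ M) :
    ∫ ω, f ω.1 * g (observe c a ω) ∂drawLaw V A δ =
      ∫ ω, gibbs c δ a f (observe c a ω) * g (observe c a ω) ∂drawLaw V A δ := by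
  have := isProbabilityMeasure_drawLaw (V := V) (A := A) hδ
  obtain ⟨B, hB⟩ : ∃ B, ∀ σ, |f σ| ≤ B := by
    obtain ⟨B, hB⟩ := (Set.finite_range fun σ => |f σ|).bddAbove
    exact ⟨B, fun σ => hB ⟨σ, rfl⟩⟩
  have hB0 : 0 ≤ B := (abs_nonneg _).trans (hB 1)
  have hf : Measurable f := measurable_of_countable _
  have hobs := measurable_observe c a
  have hgb := measurable_gibbs c δ a f
  have hM0 : 0 ≤ M := (abs_nonneg _).trans (hM (1, 0))
  have i1 : Integrable (fun ω : Draw V A => f ω.1 * g (observe c a ω)) (drawLaw V A δ) := by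
    refine Integrable.of_bound (C := B * M) (by fun_prop) (ae_of_all _ fun ω => ?_)
    rw [Real.norm_eq_abs, abs_mul]
    exact mul_le_mul (hB _) (hM _) (abs_nonneg _) hB0
  have i2 : Integrable (fun ω : Draw V A => gibbs c δ a f (observe c a ω) * g (observe c a ω))
      (drawLaw V A δ) := by
    refine Integrable.of_bound (C := B * M) (by fun_prop) (ae_of_all _ fun ω => ?_)
    rw [Real.norm_eq_abs, abs_mul]
    exact mul_le_mul (abs_gibbs_le c hδ a hB0 hB _) (hM _) (abs_nonneg _) hB0
  rw [(integral_drawLaw_observe c hδ a (F := fun p => f p.1 * g p.2) (by fun_prop) i1).2,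
    (integral_drawLaw_observe c hδ a (F := fun p => gibbs c δ a f p.2 * g p.2)
      (by fun_prop) i2).2]
  congr 1
  refine integral_congr_ae (ae_of_all _ fun y => ?_)
  simp only
  -- Under the reference measure the data have weight `partition`, which cancels the denominator of
  -- `gibbs`.
  rw [← Finset.sum_mul, ← partition, ← mul_assoc, partition_mul_gibbs c hδ, Finset.sum_mul]
  exact Finset.sum_congr rfl fun σ _ => by ring

/-! ### Log-partition functions -/

/-- The log of a weighted sum of exponentials is `1`-Lipschitz for the sup norm. -/
theorem log_sum_exp_le {ι : Type*} [Fintype ι] {w x x' : ι → ℝ} (hw : ∀ i, 0 ≤ w i) {M : ℝ}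
    (hM : 0 ≤ M) (h : ∀ i, x i ≤ x' i + M) :
    Real.log (∑ i, w i * Real.exp (x i)) ≤ Real.log (∑ i, w i * Real.exp (x' i)) + M := by
  have hle : ∑ i, w i * Real.exp (x i) ≤ (∑ i, w i * Real.exp (x' i)) * Real.exp M := by
    rw [Finset.sum_mul]
    refine Finset.sum_le_sum fun i _ => ?_
    rw [mul_assoc, ← Real.exp_add]
    exact mul_le_mul_of_nonneg_left (Real.exp_le_exp.2 (h i)) (hw i)
  rcases (Finset.sum_nonneg fun i (_ : i ∈ Finset.univ) =>
    mul_nonneg (hw i) (Real.exp_pos (x i)).le).eq_or_lt with h0 | h0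
  -- A zero sum forces all weights to vanish, so both logarithms are `Real.log 0 = 0`.
  · have h1 : ∑ i, w i * Real.exp (x' i) = 0 := by
      have h2 := (Finset.sum_eq_zero_iff_of_nonneg fun i _ =>
        mul_nonneg (hw i) (Real.exp_pos (x i)).le).1 h0.symm
      refine Finset.sum_eq_zero fun i hi => ?_
      have := (mul_eq_zero.1 (h2 i hi)).resolve_right (Real.exp_ne_zero _)
      rw [this, zero_mul]
    rw [← h0, h1]
    simpa using hM
  · have h1 : 0 < ∑ i, w i * Real.exp (x' i) :=
      pos_of_mul_pos_left (h0.trans_le hle) (Real.exp_pos M).le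
    refine (Real.log_le_log h0 hle).trans ?_
    rw [Real.log_mul h1.ne' (Real.exp_ne_zero _), Real.log_exp]

theorem abs_log_sum_exp_sub_le {ι : Type*} [Fintype ι] {w x x' : ι → ℝ} (hw : ∀ i, 0 ≤ w i)
    {M : ℝ} (hM : 0 ≤ M) (h : ∀ i, |x i - x' i| ≤ M) :
    |Real.log (∑ i, w i * Real.exp (x i)) - Real.log (∑ i, w i * Real.exp (x' i))| ≤ M := by
  have h1 := log_sum_exp_le (x := x) (x' := x') hw hM fun i => by
    linarith [(abs_le.1 (h i)).2]
  have h2 := log_sum_exp_le (x := x') (x' := x) hw hM fun i => by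
    linarith [(abs_le.1 (h i)).1]
  exact abs_le.2 ⟨by linarith, by linarith⟩

theorem abs_expo_le (a : Sym2 V → ℝ) (σ : V → ℤˣ) (z : Sym2 V → ℝ) :
    |expo a σ z| ≤ ∑ e, (|a e| * |z e| + a e ^ 2 / 2) := by
  refine (Finset.abs_sum_le_sum_abs _ _).trans (Finset.sum_le_sum fun e _ => ?_)
  refine (abs_sub _ _).trans ?_
  rw [abs_mul, abs_mul, abs_sgn, mul_one, abs_of_nonneg (by positivity : 0 ≤ a e ^ 2 / 2)]

/-- With the exponents set to zero only the discrete data matter, and they take finitely many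
values; this gives `C`. Restoring the exponents costs at most their sup norm, which is linear in the
Gaussian data and hence integrable. -/
theorem exists_abs_log_partition_le (c : A → Sym2 V) {δ : ℝ} (hδ : δ ∈ Set.Icc (-1 : ℝ) 1) :
    ∃ C, ∀ a y, |Real.log (partition c δ a y)| ≤ C + ∑ e, (|a e| * |y.2 e| + a e ^ 2 / 2) := by
  obtain ⟨C, hC⟩ := (Set.finite_range fun k : A → ℤˣ =>
    |Real.log (∑ σ : V → ℤˣ, wt c δ σ k * Real.exp 0)|).bddAbove
  refine ⟨C, fun a y => ?_⟩
  have h1 := abs_log_sum_exp_sub_le (w := fun σ => wt c δ σ y.1) (x := fun σ => expo a σ y.2)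
    (x' := fun _ => 0) (fun σ => wt_nonneg c hδ σ y.1)
    ((abs_nonneg _).trans (abs_expo_le a 1 y.2))
    (fun σ => by rw [sub_zero]; exact abs_expo_le a σ y.2)
  have h2 := hC ⟨y.1, rfl⟩
  simp only at h2
  have h3 := abs_sub_abs_le_abs_sub (Real.log (partition c δ a y))
    (Real.log (∑ σ : V → ℤˣ, wt c δ σ y.1 * Real.exp 0))
  have h4 : |Real.log (partition c δ a y) -
    Real.log (∑ σ : V → ℤˣ, wt c δ σ y.1 * Real.exp 0)| ≤ _ := h1
  linarith

theorem integrable_noise {δ : ℝ} (hδ : δ ∈ Set.Icc (-1 : ℝ) 1) (e : Sym2 V) :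
    Integrable (fun ω : Draw V A => ω.2.2 e) (drawLaw V A δ) := by
  have := isProbabilityMeasure_flip hδ
  have := isProbabilityMeasure_noiseLaw (V := V) (A := A) hδ
  have h0 : Integrable (fun x : ℝ => x) (gaussianReal 0 1) :=
    memLp_one_iff_integrable.1 (memLp_id_gaussianReal 1)
  have h1 : Integrable (fun z : Sym2 V → ℝ => z e) (Measure.pi fun _ => gaussianReal 0 1) :=
    (measurePreserving_eval (fun _ : Sym2 V => gaussianReal 0 1) e).integrable_comp_of_integrable h0
  have h2 : Integrable (fun w : Obs V A => w.2 e) (noiseLaw V A δ) :=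
    measurePreserving_snd.integrable_comp_of_integrable h1
  exact measurePreserving_snd.integrable_comp_of_integrable h2

theorem integrable_log_partition (c : A → Sym2 V) {δ : ℝ} (hδ : δ ∈ Set.Icc (-1 : ℝ) 1)
    (a b : Sym2 V → ℝ) :
    Integrable (fun ω => Real.log (partition c δ a (observe c b ω))) (drawLaw V A δ) := by
  have := isProbabilityMeasure_drawLaw (V := V) (A := A) hδ
  obtain ⟨C, hC⟩ := exists_abs_log_partition_le c hδ
  have hm := (measurable_partition c δ a).log.comp (measurable_observe c b)
  refine Integrable.mono' (g := fun ω => C + ∑ e, (|a e| * (|b e| + |ω.2.2 e|) + a e ^ 2 / 2))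
    ?_ hm.aestronglyMeasurable (ae_of_all _ fun ω => ?_)
  · refine (integrable_const _).add (integrable_finsetSum _ fun e _ => ?_)
    exact (((integrable_const _).add (integrable_noise hδ e).abs).const_mul _).add
      (integrable_const _)
  · refine (hC a _).trans (add_le_add le_rfl (Finset.sum_le_sum fun e _ => ?_))
    refine add_le_add (mul_le_mul_of_nonneg_left ?_ (abs_nonneg _)) le_rfl
    refine (abs_add_le _ _).trans ?_
    rw [abs_mul, abs_sgn, mul_one]

/-- The average log-partition function of the model with amplitudes `a`, for data generated with
amplitudes `b`. -/
def crossEnergy (c : A → Sym2 V) (δ : ℝ) (a b : Sym2 V → ℝ) : ℝ :=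
  ∫ ω, Real.log (partition c δ a (observe c b ω)) ∂drawLaw V A δ

/-- The free energy. -/
def freeEnergy (c : A → Sym2 V) (δ : ℝ) (a : Sym2 V → ℝ) : ℝ := crossEnergy c δ a a

theorem integrable_partition_and_integral (c : A → Sym2 V) {δ : ℝ}
    (hδ : δ ∈ Set.Icc (-1 : ℝ) 1) (a : Sym2 V → ℝ) :
    Integrable (partition c δ a) (noiseLaw V A 0) ∧
      (1 / 2 : ℝ) ^ Fintype.card V * ∫ y, partition c δ a y ∂noiseLaw V A 0 = 1 := by
  have := isProbabilityMeasure_drawLaw (V := V) (A := A) hδ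
  have h := integral_drawLaw_observe c hδ a (F := fun _ => 1) measurable_const
    (integrable_const _)
  simp only [mul_one] at h
  refine ⟨h.1, ?_⟩
  have h2 := h.2.symm
  rw [integral_const, probReal_univ, one_smul] at h2
  exact h2

theorem crossEnergy_eq (c : A → Sym2 V) {δ : ℝ} (hδ : δ ∈ Set.Icc (-1 : ℝ) 1)
    (a b : Sym2 V → ℝ) :
    Integrable (fun y => partition c δ b y * Real.log (partition c δ a y)) (noiseLaw V A 0) ∧
    crossEnergy c δ a b = (1 / 2 : ℝ) ^ Fintype.card V *
      ∫ y, partition c δ b y * Real.log (partition c δ a y) ∂noiseLaw V A 0 := by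
  have hm := (measurable_partition c δ a).log
  have h := integral_drawLaw_observe c hδ b
    (F := fun p => Real.log (partition c δ a p.2)) (hm.comp measurable_snd)
    (integrable_log_partition c hδ a b)
  simp only [← Finset.sum_mul] at h
  exact h

/-- Exponentials never vanish, so the zero set is the same for all amplitudes. This allows ratios of
partition functions with different amplitudes. -/
theorem partition_eq_zero_iff (c : A → Sym2 V) {δ : ℝ} (hδ : δ ∈ Set.Icc (-1 : ℝ) 1)
    (a : Sym2 V → ℝ) (y : Obs V A) : partition c δ a y = 0 ↔ ∀ σ, wt c δ σ y.1 = 0 := by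
  rw [partition, Finset.sum_eq_zero_iff_of_nonneg fun σ _ => lik_nonneg c hδ a σ y]
  simp [lik, Real.exp_ne_zero]

/-- The model that generated the data maximizes the average log-likelihood. -/
theorem crossEnergy_le (c : A → Sym2 V) {δ : ℝ} (hδ : δ ∈ Set.Icc (-1 : ℝ) 1)
    (a b : Sym2 V → ℝ) : crossEnergy c δ a b ≤ crossEnergy c δ b b := by
  obtain ⟨i1, e1⟩ := crossEnergy_eq c hδ a b
  obtain ⟨i2, e2⟩ := crossEnergy_eq c hδ b b
  obtain ⟨ia, ea⟩ := integrable_partition_and_integral c hδ a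
  obtain ⟨ib, eb⟩ := integrable_partition_and_integral c hδ b
  have hpos : (0 : ℝ) < (1 / 2 : ℝ) ^ Fintype.card V := by positivity
  have h : ∫ y, (partition c δ b y - partition c δ a y) ∂noiseLaw V A 0 ≤
      ∫ y, (partition c δ b y * Real.log (partition c δ b y) -
        partition c δ b y * Real.log (partition c δ a y)) ∂noiseLaw V A 0 := by
    refine integral_mono (ib.sub ia) (i2.sub i1) fun y => ?_
    simp only
    by_cases hb : partition c δ b y = 0
    · have ha := (partition_eq_zero_iff c hδ a y).2 ((partition_eq_zero_iff c hδ b y).1 hb)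
      simp [ha, hb]
    · have ha : partition c δ a y ≠ 0 := fun h =>
        hb ((partition_eq_zero_iff c hδ b y).2 ((partition_eq_zero_iff c hδ a y).1 h))
      have pb := (partition_nonneg c hδ b y).lt_of_ne' hb
      have pa := (partition_nonneg c hδ a y).lt_of_ne' ha
      -- Gibbs' inequality in pointwise form, from `log x ≤ x - 1` at the likelihood ratio. Both
      -- partition functions have the same total mass, so the linear terms cancel after integration.
      have h1 := Real.log_le_sub_one_of_pos (div_pos pa pb)
      rw [Real.log_div ha hb] at h1
      have h2 := mul_le_mul_of_nonneg_left h1 pb.le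
      rw [mul_sub, mul_sub, mul_div_cancel₀ _ hb] at h2
      linarith
  rw [integral_sub ib ia, integral_sub i2 i1] at h
  rw [e1, e2]
  have h3 := mul_le_mul_of_nonneg_left h hpos.le
  rw [mul_sub, mul_sub, ea, eb] at h3
  linarith

/-- Integrating `z - 1 ≤ z log z` against the reference noise gives the lower bound `1 - 2 ^
(-|V|)`. -/
theorem freeEnergy_nonneg (c : A → Sym2 V) {δ : ℝ} (hδ : δ ∈ Set.Icc (-1 : ℝ) 1)
    (a : Sym2 V → ℝ) : 0 ≤ freeEnergy c δ a := by
  have := isProbabilityMeasure_noiseLaw (V := V) (A := A) (δ := 0) ⟨by norm_num, by norm_num⟩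
  obtain ⟨i1, e1⟩ := crossEnergy_eq c hδ a a
  obtain ⟨ia, ea⟩ := integrable_partition_and_integral c hδ a
  have hpos : (0 : ℝ) < (1 / 2 : ℝ) ^ Fintype.card V := by positivity
  have hle : (1 / 2 : ℝ) ^ Fintype.card V ≤ 1 := pow_le_one₀ (by norm_num) (by norm_num)
  have h : ∫ y, (partition c δ a y - 1) ∂noiseLaw V A 0 ≤
      ∫ y, partition c δ a y * Real.log (partition c δ a y) ∂noiseLaw V A 0 := by
    refine integral_mono (ia.sub (integrable_const _)) i1 fun y => ?_
    have := Real.self_sub_one_le_mul_log (partition_nonneg c hδ a y)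
    exact this
  rw [integral_sub ia (integrable_const _)] at h
  have h3 := mul_le_mul_of_nonneg_left h hpos.le
  rw [mul_sub, ea, integral_const, probReal_univ, one_smul, mul_one] at h3
  rw [freeEnergy, e1]
  linarith

/-! ### Derivative of the free energy -/

/-- No positivity of the sum is required: if it vanishes then all weights do, the function is
constantly `log 0 = 0`, and the formula with division by zero also gives zero. Differentiability
thus holds for every sample point. -/
theorem hasFDerivAt_log_sum_exp {ι H : Type*} [Fintype ι] [NormedAddCommGroup H] [NormedSpace ℝ H]
    {w : ι → ℝ} (hw : ∀ i, 0 ≤ w i) {x : ι → H → ℝ} {x' : ι → H →L[ℝ] ℝ} {p : H}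
    (h : ∀ i, HasFDerivAt (x i) (x' i) p) :
    HasFDerivAt (fun q => Real.log (∑ i, w i * Real.exp (x i q)))
      (∑ i, (w i * Real.exp (x i p) / ∑ j, w j * Real.exp (x j p)) • x' i) p := by
  by_cases h0 : ∑ j, w j * Real.exp (x j p) = 0
  · have h2 := (Finset.sum_eq_zero_iff_of_nonneg fun i _ =>
      mul_nonneg (hw i) (Real.exp_pos (x i p)).le).1 h0
    have h3 : ∀ i, w i = 0 := fun i =>
      (mul_eq_zero.1 (h2 i (Finset.mem_univ i))).resolve_right (Real.exp_ne_zero _)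
    simp only [h3, zero_mul, zero_div, zero_smul, Finset.sum_const_zero, Real.log_zero]
    exact hasFDerivAt_const _ _
  · have h1 : HasFDerivAt (fun q => ∑ i, w i * Real.exp (x i q))
        (∑ i, w i • (Real.exp (x i p) • x' i)) p :=
      HasFDerivAt.fun_sum fun i _ => (h i).exp.const_mul (w i)
    refine (h1.log h0).congr_fderiv ?_
    rw [Finset.smul_sum]
    refine Finset.sum_congr rfl fun i _ => ?_
    rw [smul_smul, smul_smul]
    congr 1
    field_simp

theorem norm_sum_div_smul_le {ι E : Type*} [Fintype ι] [NormedAddCommGroup E] [NormedSpace ℝ E]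
    {w : ι → ℝ} (hw : ∀ i, 0 ≤ w i) {x : ι → E} {M : ℝ} (hM : 0 ≤ M) (hx : ∀ i, ‖x i‖ ≤ M) :
    ‖∑ i, (w i / ∑ j, w j) • x i‖ ≤ M := by
  have hs : 0 ≤ ∑ j, w j := Finset.sum_nonneg fun i _ => hw i
  calc ‖∑ i, (w i / ∑ j, w j) • x i‖ ≤ ∑ i, (w i / ∑ j, w j) * M := by
        refine (norm_sum_le _ _).trans (Finset.sum_le_sum fun i _ => ?_)
        rw [norm_smul, Real.norm_of_nonneg (div_nonneg (hw i) hs)]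
        exact mul_le_mul_of_nonneg_left (hx i) (div_nonneg (hw i) hs)
    _ = ((∑ i, w i) / ∑ j, w j) * M := by rw [← Finset.sum_mul, Finset.sum_div]
    _ ≤ 1 * M := mul_le_mul_of_nonneg_right (div_self_le_one _) hM
    _ = M := one_mul M

/-- The derivative of `(a, b) ↦ expo a σ (b * sgn θ + z)`. -/
def expoDeriv (σ θ : V → ℤˣ) (z : Sym2 V → ℝ) (p : (Sym2 V → ℝ) × (Sym2 V → ℝ)) :
    (Sym2 V → ℝ) × (Sym2 V → ℝ) →L[ℝ] ℝ :=
  ∑ e, ((sgn σ e * (p.2 e * sgn θ e + z e) - p.1 e) •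
      (ContinuousLinearMap.proj (R := ℝ) (φ := fun _ : Sym2 V => ℝ) e).comp
        (ContinuousLinearMap.fst ℝ (Sym2 V → ℝ) (Sym2 V → ℝ)) +
    (p.1 e * sgn σ e * sgn θ e) •
      (ContinuousLinearMap.proj (R := ℝ) (φ := fun _ : Sym2 V => ℝ) e).comp
        (ContinuousLinearMap.snd ℝ (Sym2 V → ℝ) (Sym2 V → ℝ)))

theorem hasFDerivAt_expo (σ θ : V → ℤˣ) (z : Sym2 V → ℝ) (p : (Sym2 V → ℝ) × (Sym2 V → ℝ)) :
    HasFDerivAt (fun q : (Sym2 V → ℝ) × (Sym2 V → ℝ) =>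
      expo q.1 σ (fun e => q.2 e * sgn θ e + z e)) (expoDeriv σ θ z p) p := by
  refine HasFDerivAt.fun_sum fun e _ => ?_
  have h1 : HasFDerivAt (fun q : (Sym2 V → ℝ) × (Sym2 V → ℝ) => q.1 e)
    ((ContinuousLinearMap.proj (R := ℝ) (φ := fun _ : Sym2 V => ℝ) e).comp
        (ContinuousLinearMap.fst ℝ (Sym2 V → ℝ) (Sym2 V → ℝ))) p :=
    ((ContinuousLinearMap.proj (R := ℝ) (φ := fun _ : Sym2 V => ℝ) e).comp
      (ContinuousLinearMap.fst ℝ (Sym2 V → ℝ) (Sym2 V → ℝ))).hasFDerivAt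
  have h2 : HasFDerivAt (fun q : (Sym2 V → ℝ) × (Sym2 V → ℝ) => q.2 e)
    ((ContinuousLinearMap.proj (R := ℝ) (φ := fun _ : Sym2 V => ℝ) e).comp
        (ContinuousLinearMap.snd ℝ (Sym2 V → ℝ) (Sym2 V → ℝ))) p :=
    ((ContinuousLinearMap.proj (R := ℝ) (φ := fun _ : Sym2 V => ℝ) e).comp
      (ContinuousLinearMap.snd ℝ (Sym2 V → ℝ) (Sym2 V → ℝ))).hasFDerivAt
  refine (((h1.mul_const (sgn σ e)).mul ((h2.mul_const (sgn θ e)).add_const (z e))).sub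
    ((h1.pow 2).mul_const (2⁻¹))).congr_fderiv ?_
  ext v <;> simp <;> ring

theorem norm_expoDeriv_le (σ θ : V → ℤˣ) (z : Sym2 V → ℝ)
    (p : (Sym2 V → ℝ) × (Sym2 V → ℝ)) :
    ‖expoDeriv σ θ z p‖ ≤ ∑ e, (|p.2 e| + |z e| + 2 * |p.1 e|) := by
  refine (norm_sum_le _ _).trans (Finset.sum_le_sum fun e _ => ?_)
  have hproj : ‖ContinuousLinearMap.proj (R := ℝ) (φ := fun _ : Sym2 V => ℝ) e‖ ≤ 1 :=
    ContinuousLinearMap.opNorm_le_bound _ zero_le_one fun v => by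
      rw [one_mul]; exact norm_le_pi_norm v e
  have hA : ‖(ContinuousLinearMap.proj (R := ℝ) (φ := fun _ : Sym2 V => ℝ) e).comp
      (ContinuousLinearMap.fst ℝ (Sym2 V → ℝ) (Sym2 V → ℝ))‖ ≤ 1 :=
    (ContinuousLinearMap.opNorm_comp_le _ _).trans
      (mul_le_one₀ hproj (norm_nonneg _) (ContinuousLinearMap.norm_fst_le ..))
  have hB : ‖(ContinuousLinearMap.proj (R := ℝ) (φ := fun _ : Sym2 V => ℝ) e).comp
      (ContinuousLinearMap.snd ℝ (Sym2 V → ℝ) (Sym2 V → ℝ))‖ ≤ 1 :=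
    (ContinuousLinearMap.opNorm_comp_le _ _).trans
      (mul_le_one₀ hproj (norm_nonneg _) (ContinuousLinearMap.norm_snd_le ..))
  refine (norm_add_le _ _).trans ?_
  rw [norm_smul, norm_smul]
  have h1 : ‖sgn σ e * (p.2 e * sgn θ e + z e) - p.1 e‖ ≤ |p.2 e| + |z e| + |p.1 e| := by
    rw [Real.norm_eq_abs]
    refine (abs_sub _ _).trans (add_le_add ?_ le_rfl)
    rw [abs_mul, abs_sgn, one_mul]
    refine (abs_add_le _ _).trans ?_
    rw [abs_mul, abs_sgn, mul_one]
  have h2 : ‖p.1 e * sgn σ e * sgn θ e‖ = |p.1 e| := by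
    rw [Real.norm_eq_abs, abs_mul, abs_mul, abs_sgn, abs_sgn, mul_one, mul_one]
  have h3 := mul_le_mul h1 hA (norm_nonneg _) (by positivity)
  have h4 := mul_le_mul h2.le hB (norm_nonneg _) (abs_nonneg _)
  linarith

/-- The derivative in `(a, b)` of the log-partition function. -/
def logPartitionDeriv (c : A → Sym2 V) (δ : ℝ) (ω : Draw V A)
    (p : (Sym2 V → ℝ) × (Sym2 V → ℝ)) : (Sym2 V → ℝ) × (Sym2 V → ℝ) →L[ℝ] ℝ :=
  ∑ σ, (lik c δ p.1 σ (observe c p.2 ω) / partition c δ p.1 (observe c p.2 ω)) •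
    expoDeriv σ ω.1 ω.2.2 p

theorem hasFDerivAt_log_partition (c : A → Sym2 V) {δ : ℝ} (hδ : δ ∈ Set.Icc (-1 : ℝ) 1)
    (ω : Draw V A) (p : (Sym2 V → ℝ) × (Sym2 V → ℝ)) :
    HasFDerivAt (fun q : (Sym2 V → ℝ) × (Sym2 V → ℝ) =>
      Real.log (partition c δ q.1 (observe c q.2 ω))) (logPartitionDeriv c δ ω p) p :=
  hasFDerivAt_log_sum_exp
    (w := fun σ => wt c δ σ fun e => ω.2.1 e * pairSign ω.1 (c e))
    (fun σ => wt_nonneg c hδ σ _) fun σ => hasFDerivAt_expo σ ω.1 ω.2.2 p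

theorem norm_logPartitionDeriv_le (c : A → Sym2 V) {δ : ℝ} (hδ : δ ∈ Set.Icc (-1 : ℝ) 1)
    (ω : Draw V A) (p : (Sym2 V → ℝ) × (Sym2 V → ℝ)) :
    ‖logPartitionDeriv c δ ω p‖ ≤ ∑ e, (|p.2 e| + |ω.2.2 e| + 2 * |p.1 e|) :=
  norm_sum_div_smul_le (fun σ => lik_nonneg c hδ p.1 σ _)
    (Finset.sum_nonneg fun e _ => by positivity) fun σ => norm_expoDeriv_le σ ω.1 ω.2.2 p

theorem stronglyMeasurable_logPartitionDeriv (c : A → Sym2 V) (δ : ℝ)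
    (p : (Sym2 V → ℝ) × (Sym2 V → ℝ)) :
    StronglyMeasurable fun ω : Draw V A => logPartitionDeriv c δ ω p := by
  have hobs := measurable_observe c p.2
  have hsg : ∀ e, Measurable fun ω : Draw V A => sgn ω.1 e := fun e =>
    (measurable_of_countable fun θ : V → ℤˣ => sgn θ e).comp measurable_fst
  have hz : ∀ e, Measurable fun ω : Draw V A => ω.2.2 e := fun e =>
    (measurable_pi_apply e).comp measurable_snd.snd
  refine Finset.stronglyMeasurable_fun_sum _ fun σ _ => StronglyMeasurable.fun_smul ?_ ?_
  · exact (((measurable_lik c δ p.1 σ).comp hobs).div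
      ((measurable_partition c δ p.1).comp hobs)).stronglyMeasurable
  · refine Finset.stronglyMeasurable_fun_sum _ fun e _ => StronglyMeasurable.add ?_ ?_
    · exact ((((hsg e).const_mul (p.2 e)).add (hz e)).const_mul
        (sgn σ e)|>.sub_const _).stronglyMeasurable.smul_const _
    · exact ((hsg e).const_mul _).stronglyMeasurable.smul_const _

theorem integrable_logPartitionDeriv (c : A → Sym2 V) {δ : ℝ} (hδ : δ ∈ Set.Icc (-1 : ℝ) 1)
    (p : (Sym2 V → ℝ) × (Sym2 V → ℝ)) :
    Integrable (fun ω => logPartitionDeriv c δ ω p) (drawLaw V A δ) := by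
  have := isProbabilityMeasure_drawLaw (V := V) (A := A) hδ
  refine Integrable.mono' (g := fun ω => ∑ e, (|p.2 e| + |ω.2.2 e| + 2 * |p.1 e|)) ?_
    (stronglyMeasurable_logPartitionDeriv c δ p).aestronglyMeasurable
    (ae_of_all _ fun ω => norm_logPartitionDeriv_le c hδ ω p)
  exact integrable_finsetSum _ fun e _ =>
    ((integrable_const _).add (integrable_noise hδ e).abs).add (integrable_const _)

/-- Differentiation under the integral: on the unit ball around `p` the derivative is dominated by a
linear function of the Gaussian noise. Joint differentiability allows the diagonal derivative to be
split into its two partial directions. -/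
theorem hasFDerivAt_crossEnergy (c : A → Sym2 V) {δ : ℝ} (hδ : δ ∈ Set.Icc (-1 : ℝ) 1)
    (p : (Sym2 V → ℝ) × (Sym2 V → ℝ)) :
    HasFDerivAt (fun q : (Sym2 V → ℝ) × (Sym2 V → ℝ) => crossEnergy c δ q.1 q.2)
      (∫ ω, logPartitionDeriv c δ ω p ∂drawLaw V A δ) p := by
  have := isProbabilityMeasure_drawLaw (V := V) (A := A) hδ
  unfold crossEnergy
  refine hasFDerivAt_integral_of_dominated_of_fderiv_le (μ := drawLaw V A δ) (x₀ := p)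
    (s := Metric.ball p 1)
    (F := fun q ω => Real.log (partition c δ q.1 (observe c q.2 ω)))
    (F' := fun q ω => logPartitionDeriv c δ ω q)
    (bound := fun ω => ∑ e, ((‖p‖ + 1) + |ω.2.2 e| + 2 * (‖p‖ + 1)))
    (Metric.ball_mem_nhds p one_pos)
    (Eventually.of_forall fun q => (integrable_log_partition c hδ q.1 q.2).aestronglyMeasurable)
    (integrable_log_partition c hδ p.1 p.2)
    (stronglyMeasurable_logPartitionDeriv c δ p).aestronglyMeasurable
    (ae_of_all _ fun ω q hq => ?_) ?_
    (ae_of_all _ fun ω q _ => hasFDerivAt_log_partition c hδ ω q)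
  · have hn : ‖q‖ ≤ ‖p‖ + 1 := by
      have h1 := norm_le_norm_add_norm_sub' q p
      rw [mem_ball_iff_norm] at hq
      linarith
    refine (norm_logPartitionDeriv_le c hδ ω q).trans (Finset.sum_le_sum fun e _ => ?_)
    have h1 : |q.1 e| ≤ ‖p‖ + 1 := ((norm_le_pi_norm q.1 e).trans (norm_fst_le q)).trans hn
    have h2 : |q.2 e| ≤ ‖p‖ + 1 := ((norm_le_pi_norm q.2 e).trans (norm_snd_le q)).trans hn
    linarith
  · exact integrable_finsetSum _ fun e _ =>
      ((integrable_const _).add (integrable_noise hδ e).abs).add (integrable_const _)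

/-- The mean squared posterior correlation along the pair `e`. -/
def overlap (c : A → Sym2 V) (δ : ℝ) (a : Sym2 V → ℝ) (e : Sym2 V) : ℝ :=
  ∫ ω, gibbs c δ a (fun σ => sgn σ e) (observe c a ω) ^ 2 ∂drawLaw V A δ

/-- In the data direction only the signal inside the observation moves, so the true sign at `e` is
paired with its posterior mean. -/
theorem logPartitionDeriv_apply_snd (c : A → Sym2 V) (δ : ℝ) (ω : Draw V A)
    (p : (Sym2 V → ℝ) × (Sym2 V → ℝ)) (v : Sym2 V → ℝ) :
    logPartitionDeriv c δ ω p (0, v) = ∑ e, p.1 e * v e *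
      (sgn ω.1 e * gibbs c δ p.1 (fun σ => sgn σ e) (observe c p.2 ω)) := by
  simp only [logPartitionDeriv, expoDeriv, gibbs, sum_apply,
    smul_apply, add_apply, ContinuousLinearMap.comp_apply,
    ContinuousLinearMap.coe_fst', ContinuousLinearMap.coe_snd', ContinuousLinearMap.proj_apply,
    Pi.zero_apply, smul_eq_mul, mul_zero, zero_add, Finset.mul_sum, Finset.sum_div]
  rw [Finset.sum_comm]
  refine Finset.sum_congr rfl fun e _ => Finset.sum_congr rfl fun σ _ => ?_
  ring

theorem abs_gibbs_sgn_le (c : A → Sym2 V) {δ : ℝ} (hδ : δ ∈ Set.Icc (-1 : ℝ) 1)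
    (a : Sym2 V → ℝ) (e : Sym2 V) (y : Obs V A) : |gibbs c δ a (fun σ => sgn σ e) y| ≤ 1 :=
  abs_gibbs_le c hδ a zero_le_one (fun σ => (abs_sgn σ e).le) y

/-- The derivative along the diagonal is the sum of the two partial derivatives. The one in the
model amplitudes vanishes, since by `crossEnergy_le` the diagonal point maximizes `crossEnergy` in
that direction. -/
theorem hasFDerivAt_freeEnergy (c : A → Sym2 V) {δ : ℝ} (hδ : δ ∈ Set.Icc (-1 : ℝ) 1)
    (a : Sym2 V → ℝ) :
    ∃ L : (Sym2 V → ℝ) →L[ℝ] ℝ, HasFDerivAt (freeEnergy c δ) L a ∧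
      ∀ v, L v = ∑ e, a e * v e * overlap c δ a e := by
  have := isProbabilityMeasure_drawLaw (V := V) (A := A) hδ
  have hR := hasFDerivAt_crossEnergy c hδ (a, a)
  set R := ∫ ω, logPartitionDeriv c δ ω (a, a) ∂drawLaw V A δ with hRdef
  have hdiag : HasFDerivAt (fun b : Sym2 V → ℝ => (b, b))
      ((ContinuousLinearMap.id ℝ _).prod (ContinuousLinearMap.id ℝ _)) a :=
    (hasFDerivAt_id a).prodMk (hasFDerivAt_id a)
  have hfst : HasFDerivAt (fun b : Sym2 V → ℝ => (b, a))
      ((ContinuousLinearMap.id ℝ _).prod 0) a :=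
    (hasFDerivAt_id a).prodMk (hasFDerivAt_const a a)
  have h1 := HasFDerivAt.comp a (f := fun b : Sym2 V → ℝ => (b, b)) hR hdiag
  have h2 := HasFDerivAt.comp a (f := fun b : Sym2 V → ℝ => (b, a)) hR hfst
  have hmax : IsLocalMax ((fun q : (Sym2 V → ℝ) × (Sym2 V → ℝ) => crossEnergy c δ q.1 q.2) ∘
      fun b : Sym2 V → ℝ => (b, a)) a :=
    Eventually.of_forall fun b => crossEnergy_le c hδ b a
  have h3 := hmax.hasFDerivAt_eq_zero h2
  refine ⟨_, h1, fun v => ?_⟩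
  have h4 : R (v, 0) = 0 := congrArg (fun T : (Sym2 V → ℝ) →L[ℝ] ℝ => T v) h3
  have h5 : (R.comp ((ContinuousLinearMap.id ℝ _).prod (ContinuousLinearMap.id ℝ _))) v =
      R (v, 0) + R (0, v) := by
    rw [← map_add]; simp
  rw [h5, h4, zero_add, hRdef, ContinuousLinearMap.integral_apply
    (integrable_logPartitionDeriv c hδ (a, a))]
  simp only [logPartitionDeriv_apply_snd]
  have hobs := measurable_observe c a
  have hint : ∀ e, Integrable (fun ω : Draw V A =>
      sgn ω.1 e * gibbs c δ a (fun σ => sgn σ e) (observe c a ω)) (drawLaw V A δ) := fun e => by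
    have hsg : Measurable fun ω : Draw V A => sgn ω.1 e :=
      (measurable_of_countable fun θ : V → ℤˣ => sgn θ e).comp measurable_fst
    refine Integrable.of_bound (C := 1)
      (hsg.mul ((measurable_gibbs c δ a _).comp hobs)).aestronglyMeasurable
      (ae_of_all _ fun ω => ?_)
    rw [Real.norm_eq_abs, abs_mul, abs_sgn, one_mul]
    exact abs_gibbs_sgn_le c hδ a e _
  rw [integral_finsetSum _ fun e _ => (hint e).const_mul _]
  refine Finset.sum_congr rfl fun e _ => ?_
  -- Nishimori identity: paired with a function of the data, the true sign may be replaced by its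
  -- posterior mean, which produces the square.
  rw [integral_const_mul, overlap, integral_mul_eq_integral_gibbs_mul c hδ a (fun σ => sgn σ e)
    (measurable_gibbs c δ a _) (abs_gibbs_sgn_le c hδ a e)]
  simp only [sq]

theorem hasDerivAt_freeEnergy (c : A → Sym2 V) {δ : ℝ} (hδ : δ ∈ Set.Icc (-1 : ℝ) 1)
    {a : ℝ → Sym2 V → ℝ} {a' : Sym2 V → ℝ} {t : ℝ}
    (ha : ∀ e, HasDerivAt (fun s => a s e) (a' e) t) :
    HasDerivAt (fun s => freeEnergy c δ (a s)) (∑ e, a t e * a' e * overlap c δ (a t) e) t := by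
  obtain ⟨L, hL, hv⟩ := hasFDerivAt_freeEnergy c hδ (a t)
  rw [← hv]
  exact hL.comp_hasDerivAt t (hasDerivAt_pi.2 ha)

theorem continuous_freeEnergy (c : A → Sym2 V) {δ : ℝ} (hδ : δ ∈ Set.Icc (-1 : ℝ) 1) :
    Continuous (freeEnergy c δ) :=
  continuous_iff_continuousAt.2 fun a =>
    let ⟨_, hL, _⟩ := hasFDerivAt_freeEnergy c hδ a
    hL.continuousAt

/-! ### The Bayes estimator -/

/-- The conditional expectation given the observations is the posterior mean. -/
theorem gibbs_ae_eq_condExp (c : A → Sym2 V) {δ : ℝ} (hδ : δ ∈ Set.Icc (-1 : ℝ) 1)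
    (a : Sym2 V → ℝ) (f : (V → ℤˣ) → ℝ) :
    (fun ω => gibbs c δ a f (observe c a ω)) =ᵐ[drawLaw V A δ]
      (drawLaw V A δ)[fun ω => f ω.1 |
        MeasurableSpace.comap (observe c a) (inferInstance : MeasurableSpace (Obs V A))] := by
  have := isProbabilityMeasure_drawLaw (V := V) (A := A) hδ
  obtain ⟨B, hB⟩ : ∃ B, ∀ σ, |f σ| ≤ B := by
    obtain ⟨B, hB⟩ := (Set.finite_range fun σ => |f σ|).bddAbove
    exact ⟨B, fun σ => hB ⟨σ, rfl⟩⟩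
  have hB0 : 0 ≤ B := (abs_nonneg _).trans (hB 1)
  have hf : Measurable f := measurable_of_countable _
  have hobs := measurable_observe c a
  have hgb := measurable_gibbs c δ a f
  have hfi : Integrable (fun ω : Draw V A => f ω.1) (drawLaw V A δ) :=
    Integrable.of_bound (C := B) (by fun_prop) (ae_of_all _ fun ω => hB _)
  have hgi : Integrable (fun ω : Draw V A => gibbs c δ a f (observe c a ω)) (drawLaw V A δ) :=
    Integrable.of_bound (C := B) (hgb.comp hobs).aestronglyMeasurable
      (ae_of_all _ fun ω => abs_gibbs_le c hδ a hB0 hB _)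
  refine ae_eq_condExp_of_forall_setIntegral_eq hobs.comap_le hfi
    (fun s _ _ => hgi.integrableOn) ?_
    (hgb.comp (comap_measurable _)).stronglyMeasurable.aestronglyMeasurable
  rintro s ⟨t, ht, rfl⟩ -
  have key := integral_mul_eq_integral_gibbs_mul c hδ a f (g := t.indicator fun _ => (1 : ℝ))
    (measurable_const.indicator ht) (M := 1) fun y => by
      by_cases hy : y ∈ t <;> simp [hy]
  have hind : ∀ F : Draw V A → ℝ, ∫ ω in observe c a ⁻¹' t, F ω ∂drawLaw V A δ =
      ∫ ω, F ω * t.indicator (fun _ => (1 : ℝ)) (observe c a ω) ∂drawLaw V A δ := by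
    intro F
    rw [← integral_indicator (hobs ht)]
    refine integral_congr_ae (ae_of_all _ fun ω => ?_)
    by_cases hy : observe c a ω ∈ t <;> simp [Set.indicator, hy]
  rw [hind, hind, key]

/-- The posterior mean of the constant 1 is 0 wherever the partition function vanishes, so the value
is obtained in expectation, by applying the conditional-average identity twice. -/
theorem overlap_diag (c : A → Sym2 V) {δ : ℝ} (hδ : δ ∈ Set.Icc (-1 : ℝ) 1)
    (a : Sym2 V → ℝ) (u : V) : overlap c δ a s(u, u) = 1 := by
  have := isProbabilityMeasure_drawLaw (V := V) (A := A) hδ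
  have h1 : ∀ σ : V → ℤˣ, sgn σ s(u, u) = 1 := fun σ => by
    simp [sgn, pairSign]
  have h2 := integral_mul_eq_integral_gibbs_mul c hδ a (fun _ => 1) (g := fun _ => 1)
    measurable_const (M := 1) fun _ => by simp
  have h3 := integral_mul_eq_integral_gibbs_mul c hδ a (fun _ => 1)
    (measurable_gibbs c δ a fun _ => 1)
    (abs_gibbs_le c hδ a zero_le_one fun _ => by simp)
  simp only [overlap, h1, sq]
  rw [← h3]
  simp only [one_mul, mul_one] at h2 ⊢
  rw [← h2]
  simp

/-- The sum over the ordered pairs and over the diagonal is twice the sum over the unordered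
pairs. -/
theorem sum_sum_add_sum_diag (F : Sym2 V → ℝ) :
    ∑ u, ∑ v, F s(u, v) + ∑ u, F s(u, u) = 2 * ∑ e, F e := by
  have h1 : ∑ u, ∑ v, F s(u, v) = ∑ e, ∑ p : V × V with s(p.1, p.2) = e, F e := by
    rw [← Fintype.sum_prod_type' (f := fun u v => F s(u, v)),
      ← Finset.sum_fiberwise (s := Finset.univ) (g := fun p : V × V => s(p.1, p.2))]
    refine Finset.sum_congr rfl fun e _ => Finset.sum_congr rfl fun p hp => ?_
    rw [(Finset.mem_filter.1 hp).2]
  have h2 : ∑ u, F s(u, u) = ∑ e, ∑ u : V with s(u, u) = e, F e := by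
    rw [← Finset.sum_fiberwise (s := Finset.univ) (g := fun u : V => s(u, u))]
    refine Finset.sum_congr rfl fun e _ => Finset.sum_congr rfl fun p hp => ?_
    rw [(Finset.mem_filter.1 hp).2]
  rw [h1, h2, ← Finset.sum_add_distrib, Finset.mul_sum]
  refine Finset.sum_congr rfl fun e _ => ?_
  induction e using Sym2.ind with
  | _ u v =>
    have e1 : (Finset.univ.filter fun p : V × V => s(p.1, p.2) = s(u, v)) =
        {(u, v), (v, u)} := by
      ext ⟨x, y⟩
      simp
    rw [e1]
    by_cases huv : u = v
    · subst huv
      have e2 : (Finset.univ.filter fun w : V => s(w, w) = s(u, u)) = {u} := by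
        ext w; simp
      rw [e2]
      simp
      ring
    · have e2 : (Finset.univ.filter fun w : V => s(w, w) = s(u, v)) = ∅ := by
        ext w
        simp only [Finset.mem_filter, Finset.mem_univ, true_and, Sym2.eq_iff, Finset.notMem_empty,
          iff_false]
        rintro (⟨rfl, rfl⟩ | ⟨rfl, rfl⟩) <;> exact huv rfl
      rw [e2, Finset.sum_pair (by simp [huv])]
      simp
      ring

/-! ### The lattice model -/

/-- The amplitude of the Gaussian observations, the same for all pairs. -/
def amp (V : Type*) [Fintype V] (η : ℝ) : Sym2 V → ℝ := fun _ => √(η / Fintype.card V)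

theorem card_box (d n : ℕ) : (box d n).card = (2 * n + 1) ^ d := by
  rw [box, Pi.card_Icc]
  simp only [Int.card_Icc, Finset.prod_const, Finset.card_univ, Fintype.card_fin]
  congr 1
  omega

theorem obs_eq_observe (d n : ℕ) (η : ℝ) :
    obs d n η = observe (fun e : Edge d n => e.1) (amp (box d n) η) := by
  have h : (Fintype.card (box d n) : ℝ) = (2 * (n : ℝ) + 1) ^ d := by
    rw [Fintype.card_coe, card_box]; push_cast; rfl
  funext ω
  simp only [obs, observe, amp, h, sgn]

theorem integral_posteriorCorr_sq (d n : ℕ) {δ : ℝ} (hδ : δ ∈ Set.Icc (-1 : ℝ) 1) (η : ℝ)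
    (u v : box d n) :
    ∫ ω, posteriorCorr d n δ η u v ω ^ 2 ∂law d n δ =
      overlap (fun e : Edge d n => e.1) δ (amp (box d n) η) s(u, v) := by
  have h := gibbs_ae_eq_condExp (fun e : Edge d n => e.1) hδ (amp (box d n) η)
    (fun σ => sgn σ s(u, v))
  have h2 : (fun ω : Sample d n => ((ω.1 u : ℤ) : ℝ) * ((ω.1 v : ℤ) : ℝ)) =
      fun ω => sgn ω.1 s(u, v) := by
    funext ω; simp [sgn, pairSign]
  rw [overlap]
  refine (integral_congr_ae ?_).symm
  have h3 : posteriorCorr d n δ η u v = (drawLaw (box d n) (Edge d n) δ)[fun ω => sgn ω.1 s(u, v) |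
      MeasurableSpace.comap (observe (fun e : Edge d n => e.1) (amp (box d n) η))
        (inferInstance : MeasurableSpace (Obs (box d n) (Edge d n)))] := by
    rw [posteriorCorr, h2, obsSigma, obs_eq_observe]
    rfl
  rw [h3]
  exact h.fun_comp (· ^ 2)

/-- The average squared posterior correlation over ordered pairs. -/
def meanOverlap (c : A → Sym2 V) (δ : ℝ) (a : Sym2 V → ℝ) : ℝ :=
  (1 / (Fintype.card V : ℝ) ^ 2) * ∑ u, ∑ v, overlap c δ a s(u, v)

theorem pairCorr_eq (d n : ℕ) {δ : ℝ} (hδ : δ ∈ Set.Icc (-1 : ℝ) 1) (η : ℝ) :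
    pairCorr d n δ η = meanOverlap (fun e : Edge d n => e.1) δ (amp (box d n) η) := by
  simp only [pairCorr, meanOverlap, integral_posteriorCorr_sq d n hδ, Fintype.card_coe]

/-- The derivative of the free energy in the signal-to-noise ratio. -/
theorem hasDerivAt_freeEnergy_amp [Nonempty V] (c : A → Sym2 V) {δ : ℝ}
    (hδ : δ ∈ Set.Icc (-1 : ℝ) 1) {η : ℝ} (hη : 0 < η) :
    HasDerivAt (fun s => freeEnergy c δ (amp V s) / Fintype.card V)
      ((meanOverlap c δ (amp V η) + 1 / Fintype.card V) / 4) η := by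
  have hN : (0 : ℝ) < Fintype.card V := by exact_mod_cast Fintype.card_pos
  have hpos : 0 < η / Fintype.card V := div_pos hη hN
  have h1 : HasDerivAt (fun s : ℝ => √(s / Fintype.card V))
      ((1 / Fintype.card V) / (2 * √(η / Fintype.card V))) η :=
    ((hasDerivAt_id η).div_const _).sqrt hpos.ne'
  have h2 := (hasDerivAt_freeEnergy c hδ (a := fun s => amp V s) fun _ => h1).div_const
    (Fintype.card V : ℝ)
  refine h2.congr_deriv ?_
  -- Amplitude times its derivative is `1/(2|V|)` for every pair. Passing from unordered to ordered
  -- pairs halves the sum and adds the diagonal, whose overlaps equal one; hence the summand `1/|V|`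
  -- and the factor `1/4`.
  have h3 := sum_sum_add_sum_diag fun e => overlap c δ (amp V η) e
  simp only [overlap_diag c hδ, Finset.sum_const, Finset.card_univ, nsmul_eq_mul, mul_one] at h3
  have hs : √(η / Fintype.card V) ≠ 0 := (Real.sqrt_pos.2 hpos).ne'
  have h4 : ∀ e, amp V η e * ((1 / Fintype.card V) / (2 * √(η / Fintype.card V))) =
      1 / (2 * Fintype.card V) := by
    intro e
    rw [amp]
    field_simp
  simp only [h4, ← Finset.mul_sum]
  rw [meanOverlap]
  have h5 : ∑ e, overlap c δ (amp V η) e =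
      (∑ u, ∑ v, overlap c δ (amp V η) s(u, v) + Fintype.card V) / 2 := by linarith
  rw [h5]
  field_simp
  ring

theorem overlap_le_one (c : A → Sym2 V) {δ : ℝ} (hδ : δ ∈ Set.Icc (-1 : ℝ) 1)
    (a : Sym2 V → ℝ) (e : Sym2 V) : overlap c δ a e ≤ 1 := by
  have := isProbabilityMeasure_drawLaw (V := V) (A := A) hδ
  have hm := (measurable_gibbs c δ a fun σ => sgn σ e).comp (measurable_observe c a)
  have hb : ∀ ω, gibbs c δ a (fun σ => sgn σ e) (observe c a ω) ^ 2 ≤ 1 := fun ω =>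
    (sq_le_one_iff_abs_le_one _).2 (abs_gibbs_sgn_le c hδ a e _)
  calc overlap c δ a e ≤ ∫ _, (1 : ℝ) ∂drawLaw V A δ :=
        integral_mono_of_nonneg (ae_of_all _ fun _ => sq_nonneg _) (integrable_const _)
          (ae_of_all _ hb)
    _ = 1 := by simp

theorem meanOverlap_le_one (c : A → Sym2 V) {δ : ℝ} (hδ : δ ∈ Set.Icc (-1 : ℝ) 1)
    (a : Sym2 V → ℝ) : meanOverlap c δ a ≤ 1 := by
  rw [meanOverlap, one_div, mul_comm, ← div_eq_mul_inv]
  refine div_le_one_of_le₀ ?_ (by positivity)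
  calc ∑ u, ∑ v, overlap c δ a s(u, v) ≤ ∑ _u : V, ∑ _v : V, (1 : ℝ) :=
        Finset.sum_le_sum fun _ _ => Finset.sum_le_sum fun _ _ => overlap_le_one c hδ a _
    _ = (Fintype.card V : ℝ) ^ 2 := by simp [sq]

/-! ### Degradation of the observations -/

theorem measurePreserving_prod_prod_comm {X Y Z W : Type*} [MeasurableSpace X]
    [MeasurableSpace Y] [MeasurableSpace Z] [MeasurableSpace W] (μ : Measure X) (ν : Measure Y)
    (ρ : Measure Z) (τ : Measure W) [SFinite μ] [SFinite ν] [SFinite ρ] [SFinite τ] :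
    MeasurePreserving (fun p : (X × Y) × (Z × W) => ((p.1.1, p.2.1), (p.1.2, p.2.2)))
      ((μ.prod ν).prod (ρ.prod τ)) ((μ.prod ρ).prod (ν.prod τ)) := by
  have h1 := measurePreserving_prodAssoc μ ν (ρ.prod τ)
  have h2 := ((measurePreserving_prodAssoc ν ρ τ).symm)
  have h3 := (Measure.measurePreserving_swap (μ := ν) (ν := ρ)).prod (MeasurePreserving.id τ)
  have h4 := measurePreserving_prodAssoc ρ ν τ
  have h5 := (measurePreserving_prodAssoc μ ρ (ν.prod τ)).symm
  exact h5.comp (((MeasurePreserving.id μ).prod (h4.comp (h3.comp h2))).comp h1)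

/-- Adding noise to the observations. -/
def degrade (ρ : ℝ) (y w : Obs V A) : Obs V A :=
  (fun e => y.1 e * w.1 e, fun e => ρ * y.2 e + √(1 - ρ ^ 2) * w.2 e)

theorem measurable_degrade (ρ : ℝ) :
    Measurable fun p : Obs V A × Obs V A => degrade ρ p.1 p.2 := by
  refine Measurable.prodMk (measurable_pi_lambda _ fun e => ?_) (measurable_pi_lambda _ fun e => ?_)
  · exact measurable_units_mul.comp
      (((measurable_pi_apply e).comp measurable_fst.fst).prodMk
        ((measurable_pi_apply e).comp measurable_snd.fst) :
        Measurable fun p : Obs V A × Obs V A => (p.1.1 e, p.2.1 e))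
  · have h1 : Measurable fun p : Obs V A × Obs V A => p.1.2 e :=
      (measurable_pi_apply e).comp measurable_fst.snd
    have h2 : Measurable fun p : Obs V A × Obs V A => p.2.2 e :=
      (measurable_pi_apply e).comp measurable_snd.snd
    exact (h1.const_mul _).add (h2.const_mul _)

/-- A sign with flip probability `(1 - δ)/2` has mean `δ`, and means of independent signs multiply.
-/
theorem signLaw_prod_map_mul {δ r : ℝ} (hδ : δ ∈ Set.Icc (-1 : ℝ) 1)
    (hr : r ∈ Set.Icc (-1 : ℝ) 1) :
    ((signLaw ((1 - δ) / 2)).prod (signLaw ((1 - r) / 2))).map (fun p => p.1 * p.2) =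
      signLaw ((1 - r * δ) / 2) := by
  have := isProbabilityMeasure_flip hδ
  have := isProbabilityMeasure_flip hr
  ext s hs
  rw [Measure.map_apply measurable_units_mul hs, Measure.prod_apply (measurable_units_mul hs)]
  have h1 : ENNReal.ofReal (1 - (1 - r * δ) / 2) =
      ENNReal.ofReal (1 - (1 - δ) / 2) * ENNReal.ofReal (1 - (1 - r) / 2) +
      ENNReal.ofReal ((1 - δ) / 2) * ENNReal.ofReal ((1 - r) / 2) := by
    rw [← ENNReal.ofReal_mul (by linarith [hδ.1]), ← ENNReal.ofReal_mul (by linarith [hδ.2]),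
      ← ENNReal.ofReal_add (mul_nonneg (by linarith [hδ.1]) (by linarith [hr.1]))
        (mul_nonneg (by linarith [hδ.2]) (by linarith [hr.2]))]
    congr 1
    ring
  have h2 : ENNReal.ofReal ((1 - r * δ) / 2) =
      ENNReal.ofReal (1 - (1 - δ) / 2) * ENNReal.ofReal ((1 - r) / 2) +
      ENNReal.ofReal ((1 - δ) / 2) * ENNReal.ofReal (1 - (1 - r) / 2) := by
    rw [← ENNReal.ofReal_mul (by linarith [hδ.1]), ← ENNReal.ofReal_mul (by linarith [hδ.2]),
      ← ENNReal.ofReal_add (mul_nonneg (by linarith [hδ.1]) (by linarith [hr.2]))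
        (mul_nonneg (by linarith [hδ.2]) (by linarith [hr.1]))]
    congr 1
    ring
  have h3 : signLaw ((1 - r * δ) / 2) s = ENNReal.ofReal (1 - (1 - r * δ) / 2) * s.indicator 1 1 +
      ENNReal.ofReal ((1 - r * δ) / 2) * s.indicator 1 (-1) := by
    simp [signLaw]
  rw [h3, h1, h2]
  simp only [signLaw, lintegral_add_measure, lintegral_smul_measure, lintegral_dirac,
    Measure.add_apply, Measure.smul_apply, Measure.dirac_apply, smul_eq_mul]
  have e1 : ∀ x y : ℤˣ, (Prod.mk x ⁻¹' ((fun p : ℤˣ × ℤˣ => p.1 * p.2) ⁻¹' s)).indicator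
      (1 : ℤˣ → ENNReal) y = s.indicator 1 (x * y) := fun x y => rfl
  simp only [e1, one_mul, mul_one, neg_mul_neg]
  ring

theorem gaussianReal_prod_map_rotate {ρ : ℝ} (hρ : ρ ∈ Set.Icc (0 : ℝ) 1) :
    ((gaussianReal 0 1).prod (gaussianReal 0 1)).map
      (fun p : ℝ × ℝ => ρ * p.1 + √(1 - ρ ^ 2) * p.2) = gaussianReal 0 1 := by
  have h1 := gaussianReal_map_const_mul (μ := 0) (v := 1) ρ
  have h2 := gaussianReal_map_const_mul (μ := 0) (v := 1) √(1 - ρ ^ 2)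
  have h3 := gaussianReal_conv_gaussianReal (m₁ := ρ * 0) (m₂ := √(1 - ρ ^ 2) * 0)
    (v₁ := NNReal.mk (ρ ^ 2) (sq_nonneg _) * 1)
    (v₂ := NNReal.mk (√(1 - ρ ^ 2) ^ 2) (sq_nonneg _) * 1)
  rw [← h1, ← h2, Measure.conv, Measure.map_prod_map _ _ (by fun_prop) (by fun_prop),
    Measure.map_map (by fun_prop) (by fun_prop)] at h3
  have h4 : ((fun x : ℝ × ℝ => x.1 + x.2) ∘
      Prod.map (fun x => ρ * x) fun x => √(1 - ρ ^ 2) * x) =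
      fun p : ℝ × ℝ => ρ * p.1 + √(1 - ρ ^ 2) * p.2 := rfl
  rw [h4] at h3
  rw [h3]
  congr 1
  · simp
  · ext
    push_cast
    rw [Real.sq_sqrt (by nlinarith [hρ.1, hρ.2])]
    ring

theorem noiseLaw_prod_map_degrade {δ r ρ : ℝ} (hδ : δ ∈ Set.Icc (-1 : ℝ) 1)
    (hr : r ∈ Set.Icc (-1 : ℝ) 1) (hρ : ρ ∈ Set.Icc (0 : ℝ) 1) :
    ((noiseLaw V A δ).prod (noiseLaw V A r)).map (fun p => degrade ρ p.1 p.2) =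
      noiseLaw V A (r * δ) := by
  have := isProbabilityMeasure_flip hδ
  have := isProbabilityMeasure_flip hr
  have h1 := pi_prod_map_pi (ι := A) (signLaw ((1 - δ) / 2)) (signLaw ((1 - r) / 2))
    measurable_units_mul
  have h2 := pi_prod_map_pi (ι := Sym2 V) (gaussianReal 0 1) (gaussianReal 0 1)
    (f := fun p : ℝ × ℝ => ρ * p.1 + √(1 - ρ ^ 2) * p.2) (by fun_prop)
  have h3 := measurePreserving_prod_prod_comm (Measure.pi fun _ : A => signLaw ((1 - δ) / 2))
    (Measure.pi fun _ : Sym2 V => gaussianReal 0 1)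
    (Measure.pi fun _ : A => signLaw ((1 - r) / 2)) (Measure.pi fun _ : Sym2 V => gaussianReal 0 1)
  have m1 : Measurable fun (p : (A → ℤˣ) × (A → ℤˣ)) i => p.1 i * p.2 i :=
    measurable_of_countable _
  have m2 : Measurable fun (p : (Sym2 V → ℝ) × (Sym2 V → ℝ)) i =>
      ρ * p.1 i + √(1 - ρ ^ 2) * p.2 i := by fun_prop
  rw [signLaw_prod_map_mul hδ hr] at h1
  simp_rw [gaussianReal_prod_map_rotate hρ] at h2
  have h4 := Measure.map_prod_map ((Measure.pi fun _ : A => signLaw ((1 - δ) / 2)).prod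
    (Measure.pi fun _ : A => signLaw ((1 - r) / 2)))
    ((Measure.pi fun _ : Sym2 V => gaussianReal 0 1).prod
      (Measure.pi fun _ : Sym2 V => gaussianReal 0 1)) m1 m2
  rw [← h3.map_eq, Measure.map_map (m1.prodMap m2) h3.measurable, h2] at h4
  refine h4.symm.trans ?_
  rw [noiseLaw, ← h1]

/-- Adding noise to the observations decreases the mean squared posterior correlations. -/
theorem overlap_degrade_le (c : A → Sym2 V) {δ r ρ : ℝ} (hδ : δ ∈ Set.Icc (-1 : ℝ) 1)
    (hr : r ∈ Set.Icc (-1 : ℝ) 1) (hρ : ρ ∈ Set.Icc (0 : ℝ) 1) (a : Sym2 V → ℝ) (e : Sym2 V) :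
    overlap c (r * δ) (fun e => ρ * a e) e ≤ overlap c δ a e := by
  have hrδ : r * δ ∈ Set.Icc (-1 : ℝ) 1 := by
    refine abs_le.1 ?_
    rw [abs_mul]
    exact mul_le_one₀ (abs_le.2 hr) (abs_nonneg _) (abs_le.2 hδ)
  have := isProbabilityMeasure_drawLaw (V := V) (A := A) hδ
  have := isProbabilityMeasure_noiseLaw (V := V) (A := A) hδ
  have := isProbabilityMeasure_noiseLaw (V := V) (A := A) hr
  set a' : Sym2 V → ℝ := fun e => ρ * a e with ha'
  set f : (V → ℤˣ) → ℝ := fun σ => sgn σ e with hf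
  set g : Obs V A → ℝ := gibbs c (r * δ) a' f with hg
  have hgm : Measurable g := measurable_gibbs c _ a' f
  have hg1 : ∀ y, |g y| ≤ 1 := abs_gibbs_sgn_le c hrδ a' e
  set h : Obs V A → ℝ := gibbs c δ a f with hh
  have hhm : Measurable h := measurable_gibbs c _ a f
  have hh1 : ∀ y, |h y| ≤ 1 := abs_gibbs_sgn_le c hδ a e
  have hfm : Measurable f := measurable_of_countable _
  have hobs := measurable_observe c a
  have hobs' := measurable_observe c a'
  have hdeg := measurable_degrade (V := V) (A := A) ρ
  have hP : ((drawLaw V A δ).prod (noiseLaw V A r)).map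
      (fun p => (p.1.1, degrade ρ p.1.2 p.2)) = drawLaw V A (r * δ) := by
    have h1 := (measurePreserving_prodAssoc (spinLaw V) (noiseLaw V A δ) (noiseLaw V A r))
    have h2 := Measure.map_prod_map (spinLaw V) ((noiseLaw V A δ).prod (noiseLaw V A r))
      measurable_id hdeg
    rw [Measure.map_id, noiseLaw_prod_map_degrade hδ hr hρ] at h2
    rw [drawLaw, drawLaw, h2, ← h1.map_eq, Measure.map_map (measurable_id.prodMap hdeg)
      h1.measurable]
    rfl
  have hΦ : Measurable fun p : Draw V A × Obs V A =>
      ((p.1.1, degrade ρ p.1.2 p.2) : Draw V A) :=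
    measurable_fst.fst.prodMk
      (hdeg.comp (measurable_fst.snd.prodMk measurable_snd))
  -- Degrading the noise and observing with amplitudes `ρ a` gives the same data as degrading the
  -- original observation.
  have hK : ∀ p : Draw V A × Obs V A, observe c a' (p.1.1, degrade ρ p.1.2 p.2) =
      degrade ρ (observe c a p.1) p.2 := by
    intro p
    refine Prod.ext (funext fun i => ?_) (funext fun i => ?_)
    · simp only [observe, degrade]
      rw [mul_right_comm]
    · simp only [observe, degrade, ha']
      ring
  have hKm : Measurable fun p : Draw V A × Obs V A => degrade ρ (observe c a p.1) p.2 :=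
    hdeg.comp ((hobs.comp measurable_fst).prodMk measurable_snd)
  have hgK := hgm.comp hKm
  have hh' : Measurable fun p : Draw V A × Obs V A => h (observe c a p.1) :=
    hhm.comp (hobs.comp measurable_fst)
  have hf' : Measurable fun p : Draw V A × Obs V A => f p.1.1 := hfm.comp measurable_fst.fst
  have tower' : overlap c (r * δ) a' e =
      ∫ p, f p.1.1 * g (degrade ρ (observe c a p.1) p.2) ∂(drawLaw V A δ).prod (noiseLaw V A r) := by
    have t := integral_mul_eq_integral_gibbs_mul c hrδ a' f hgm hg1
    have t2 : overlap c (r * δ) a' e = ∫ ω, f ω.1 * g (observe c a' ω) ∂drawLaw V A (r * δ) := by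
      rw [t, overlap]; simp only [sq]; rfl
    rw [t2, ← hP, integral_map hΦ.aemeasurable
      (by rw [hP]; exact ((hfm.comp measurable_fst).mul (hgm.comp hobs')).aestronglyMeasurable)]
    simp only [hK]
  have sq' : overlap c (r * δ) a' e =
      ∫ p, g (degrade ρ (observe c a p.1) p.2) ^ 2 ∂(drawLaw V A δ).prod (noiseLaw V A r) := by
    rw [overlap, ← hP, integral_map hΦ.aemeasurable
      (by rw [hP]; exact ((hgm.comp hobs').pow_const 2).aestronglyMeasurable)]
    simp only [hK]
    rfl
  have i1 : Integrable (fun p : Draw V A × Obs V A =>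
      f p.1.1 * g (degrade ρ (observe c a p.1) p.2)) ((drawLaw V A δ).prod (noiseLaw V A r)) := by
    refine Integrable.of_bound (C := 1) (hf'.mul hgK).aestronglyMeasurable
      (ae_of_all _ fun p => ?_)
    rw [Real.norm_eq_abs, abs_mul, hf, abs_sgn, one_mul]
    exact hg1 _
  have i2 : Integrable (fun p : Draw V A × Obs V A =>
      h (observe c a p.1) * g (degrade ρ (observe c a p.1) p.2))
      ((drawLaw V A δ).prod (noiseLaw V A r)) := by
    refine Integrable.of_bound (C := 1) (hh'.mul hgK).aestronglyMeasurable
      (ae_of_all _ fun p => ?_)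
    rw [Real.norm_eq_abs, abs_mul]
    exact mul_le_one₀ (hh1 _) (abs_nonneg _) (hg1 _)
  -- For each fixed extra noise `w`, the degraded estimator is a function of the original data, so
  -- `f` can be replaced by its finer posterior mean `h`.
  have swap : ∫ p, f p.1.1 * g (degrade ρ (observe c a p.1) p.2)
        ∂(drawLaw V A δ).prod (noiseLaw V A r) =
      ∫ p, h (observe c a p.1) * g (degrade ρ (observe c a p.1) p.2)
        ∂(drawLaw V A δ).prod (noiseLaw V A r) := by
    rw [integral_prod_symm _ i1, integral_prod_symm _ i2]
    refine integral_congr_ae (ae_of_all _ fun w => ?_)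
    exact integral_mul_eq_integral_gibbs_mul c hδ a f (g := fun y => g (degrade ρ y w))
      (hgm.comp (hdeg.comp measurable_prodMk_right)) (fun y => hg1 _)
  have j1 : Integrable (fun p : Draw V A × Obs V A => h (observe c a p.1) ^ 2)
      ((drawLaw V A δ).prod (noiseLaw V A r)) := by
    refine Integrable.of_bound (C := 1) (hh'.pow_const 2).aestronglyMeasurable
      (ae_of_all _ fun p => ?_)
    rw [Real.norm_eq_abs, abs_pow]
    exact pow_le_one₀ (abs_nonneg _) (hh1 _)
  have j2 : Integrable (fun p : Draw V A × Obs V A => g (degrade ρ (observe c a p.1) p.2) ^ 2)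
      ((drawLaw V A δ).prod (noiseLaw V A r)) := by
    refine Integrable.of_bound (C := 1) (hgK.pow_const 2).aestronglyMeasurable
      (ae_of_all _ fun p => ?_)
    rw [Real.norm_eq_abs, abs_pow]
    exact pow_le_one₀ (abs_nonneg _) (hg1 _)
  have marg : ∫ p, h (observe c a p.1) ^ 2 ∂(drawLaw V A δ).prod (noiseLaw V A r) =
      overlap c δ a e := by
    rw [integral_prod _ j1]
    simp only [integral_const, probReal_univ, one_smul]
    rfl
  -- The degraded overlap is both `E[g²]` and `E[h g]`. Since `h g ≤ (h² + g²)/2`, it is at most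
  -- `E[h²]`, the original overlap.
  have final : ∫ p, h (observe c a p.1) * g (degrade ρ (observe c a p.1) p.2)
        ∂(drawLaw V A δ).prod (noiseLaw V A r) ≤
      ∫ p, (h (observe c a p.1) ^ 2 / 2 + g (degrade ρ (observe c a p.1) p.2) ^ 2 / 2)
        ∂(drawLaw V A δ).prod (noiseLaw V A r) := by
    refine integral_mono i2 ((j1.div_const 2).add (j2.div_const 2)) fun p => ?_
    simp only
    nlinarith [sq_nonneg (h (observe c a p.1) - g (degrade ρ (observe c a p.1) p.2))]
  rw [integral_add (j1.div_const 2) (j2.div_const 2), integral_div, integral_div, marg, ← sq',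
    ← swap, ← tower'] at final
  linarith

theorem meanOverlap_mono (c : A → Sym2 V) {δ δ' η η' : ℝ} (h0 : 0 ≤ δ') (hδ : δ' ≤ δ)
    (h1 : δ ≤ 1) (hη0 : 0 ≤ η') (hη : η' ≤ η) :
    meanOverlap c δ' (amp V η') ≤ meanOverlap c δ (amp V η) := by
  -- Biases multiply and amplitudes scale, which dictates the factors `δ'/δ` and `√(η'/η)`. If a
  -- denominator vanishes, so does the numerator, and the quotient 0 still works.
  have hr : δ' / δ ∈ Set.Icc (-1 : ℝ) 1 :=
    ⟨by linarith [div_nonneg h0 (h0.trans hδ)], div_le_one_of_le₀ hδ (h0.trans hδ)⟩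
  have hρ : √(η' / η) ∈ Set.Icc (0 : ℝ) 1 :=
    ⟨Real.sqrt_nonneg _, Real.sqrt_le_one.2 (div_le_one_of_le₀ hη (hη0.trans hη))⟩
  have e1 : δ' = δ' / δ * δ := by
    rcases (h0.trans hδ).eq_or_lt with h | h
    · rw [← h, mul_zero]; exact le_antisymm (hδ.trans_eq h.symm) h0
    · rw [div_mul_cancel₀ _ h.ne']
  have e2 : amp V η' = fun e => √(η' / η) * amp V η e := by
    funext e
    simp only [amp]
    rw [← Real.sqrt_mul (div_nonneg hη0 (hη0.trans hη))]
    congr 1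
    rcases (hη0.trans hη).eq_or_lt with h | h
    · have : η' = 0 := le_antisymm (hη.trans_eq h.symm) hη0
      simp [this]
    · field_simp
  rw [meanOverlap, meanOverlap]
  refine mul_le_mul_of_nonneg_left (Finset.sum_le_sum fun u _ => Finset.sum_le_sum fun v _ => ?_)
    (by positivity)
  rw [e1, e2]
  exact overlap_degrade_le c ⟨by linarith, h1⟩ hr hρ _ _

variable {V' A' : Type*} [Fintype V'] [DecidableEq V'] [Fintype A']

/-! ### Subsystems -/

/-- Restriction of the randomness to a subsystem. -/
def restrictDraw (i : V' → V) (j : A' → A) (ω : Draw V A) : Draw V' A' :=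
  (ω.1 ∘ i, ω.2.1 ∘ j, ω.2.2 ∘ Sym2.map i)

/-- Restriction of the observations to a subsystem. -/
def restrictObs (i : V' → V) (j : A' → A) (y : Obs V A) : Obs V' A' :=
  (y.1 ∘ j, y.2 ∘ Sym2.map i)

theorem measurable_restrictDraw (i : V' → V) (j : A' → A) :
    Measurable (restrictDraw (V := V) (A := A) i j) := by
  refine Measurable.prodMk ?_ (Measurable.prodMk ?_ ?_)
  · exact measurable_pi_lambda _ fun u => (measurable_pi_apply (i u)).comp measurable_fst
  · exact measurable_pi_lambda _ fun e => (measurable_pi_apply (j e)).comp measurable_snd.fst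
  · exact measurable_pi_lambda _ fun e =>
      (measurable_pi_apply (Sym2.map i e)).comp measurable_snd.snd

theorem drawLaw_map_restrictDraw {i : V' → V} (hi : Function.Injective i) {j : A' → A}
    (hj : Function.Injective j) {δ : ℝ} (hδ : δ ∈ Set.Icc (-1 : ℝ) 1) :
    (drawLaw V A δ).map (restrictDraw i j) = drawLaw V' A' δ := by
  have := isProbabilityMeasure_flip hδ
  have h1 := pi_map_comp_injective (signLaw (1 / 2)) hi
  have h2 := pi_map_comp_injective (signLaw ((1 - δ) / 2)) hj
  have h3 := pi_map_comp_injective (gaussianReal 0 1) (Sym2.map.injective hi)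
  have m1 : Measurable fun x : V → ℤˣ => x ∘ i := measurable_of_countable _
  have m2 : Measurable fun x : A → ℤˣ => x ∘ j := measurable_of_countable _
  have m3 : Measurable fun x : Sym2 V → ℝ => x ∘ Sym2.map i :=
    measurable_pi_lambda _ fun e => measurable_pi_apply _
  have h4 := Measure.map_prod_map (Measure.pi fun _ : A => signLaw ((1 - δ) / 2))
    (Measure.pi fun _ : Sym2 V => gaussianReal 0 1) m2 m3
  have h5 := Measure.map_prod_map (Measure.pi fun _ : V => signLaw (1 / 2))
    ((Measure.pi fun _ : A => signLaw ((1 - δ) / 2)).prod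
      (Measure.pi fun _ : Sym2 V => gaussianReal 0 1)) m1 (m2.prodMap m3)
  rw [← h4, h1, h2, h3] at h5
  exact h5.symm

theorem pairSign_comp {W : Type*} (i : W → V) (θ : V → ℤˣ) (e : Sym2 W) :
    pairSign (θ ∘ i) e = pairSign θ (Sym2.map i e) := by
  induction e using Sym2.ind with
  | _ u v => rfl

theorem sgn_comp {W : Type*} (i : W → V) (θ : V → ℤˣ) (e : Sym2 W) :
    sgn (θ ∘ i) e = sgn θ (Sym2.map i e) := by rw [sgn, sgn, pairSign_comp]

theorem observe_restrictDraw {c : A → Sym2 V} {c' : A' → Sym2 V'} {i : V' → V} {j : A' → A}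
    (hc : ∀ e, c (j e) = Sym2.map i (c' e)) (a : Sym2 V → ℝ) (ω : Draw V A) :
    observe c' (a ∘ Sym2.map i) (restrictDraw i j ω) = restrictObs i j (observe c a ω) := by
  refine Prod.ext (funext fun e => ?_) (funext fun e => ?_)
  · simp only [observe, restrictDraw, restrictObs, Function.comp_apply]
    rw [hc, ← pairSign_comp]
  · simp only [observe, restrictDraw, restrictObs, Function.comp_apply, ← sgn_comp]

/-- The law of a subsystem is the image of the large law. Realizing its free energy on the large
sample space makes pointwise comparison of partition functions possible. -/
theorem integral_restrict {c : A → Sym2 V} {c' : A' → Sym2 V'} {i : V' → V} {j : A' → A}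
    (hi : Function.Injective i) (hj : Function.Injective j)
    (hc : ∀ e, c (j e) = Sym2.map i (c' e)) {δ : ℝ} (hδ : δ ∈ Set.Icc (-1 : ℝ) 1)
    (a : Sym2 V → ℝ) :
    Integrable (fun ω => Real.log (partition c' δ (a ∘ Sym2.map i)
      (restrictObs i j (observe c a ω)))) (drawLaw V A δ) ∧
    freeEnergy c' δ (a ∘ Sym2.map i) = ∫ ω, Real.log (partition c' δ (a ∘ Sym2.map i)
      (restrictObs i j (observe c a ω))) ∂drawLaw V A δ := by
  have h := integrable_log_partition c' hδ (a ∘ Sym2.map i) (a ∘ Sym2.map i)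
  have hm := measurable_restrictDraw (V := V) (A := A) i j
  have hl := (measurable_partition c' δ (a ∘ Sym2.map i)).log.comp
    (measurable_observe c' (a ∘ Sym2.map i))
  simp only [← observe_restrictDraw hc]
  rw [← drawLaw_map_restrictDraw (V := V) (A := A) hi hj hδ] at h
  refine ⟨h.comp_measurable hm, ?_⟩
  rw [freeEnergy, crossEnergy, ← drawLaw_map_restrictDraw (V := V) (A := A) hi hj hδ]
  exact integral_map hm.aemeasurable hl.aestronglyMeasurable

/-- The data have a density proportional to the partition function itself. Off this null set the
convention `Real.log 0 = 0` does not disturb logarithms of products. -/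
theorem ae_partition_ne_zero (c : A → Sym2 V) {δ : ℝ} (hδ : δ ∈ Set.Icc (-1 : ℝ) 1)
    (a : Sym2 V → ℝ) : ∀ᵐ ω ∂drawLaw V A δ, partition c δ a (observe c a ω) ≠ 0 := by
  have := isProbabilityMeasure_drawLaw (V := V) (A := A) hδ
  set Z : Set (Obs V A) := {y | partition c δ a y = 0} with hZ
  have hZm : MeasurableSet Z := measurableSet_eq_fun (measurable_partition c δ a) measurable_const
  have hF : Measurable fun p : (V → ℤˣ) × Obs V A => Z.indicator (fun _ => (1 : ℝ)) p.2 :=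
    (measurable_const.indicator hZm).comp measurable_snd
  have hobs := measurable_observe c a
  have hi : Integrable (fun ω : Draw V A => Z.indicator (fun _ => (1 : ℝ)) (observe c a ω))
      (drawLaw V A δ) := by
    refine Integrable.of_bound (C := 1)
      ((measurable_const.indicator hZm).comp hobs).aestronglyMeasurable (ae_of_all _ fun ω => ?_)
    by_cases h : observe c a ω ∈ Z <;> simp [h]
  have h1 := (integral_drawLaw_observe c hδ a hF hi).2
  have h2 : ∀ y, ∑ θ, lik c δ a θ y * Z.indicator (fun _ => (1 : ℝ)) y = 0 := by
    intro y
    rw [← Finset.sum_mul, ← partition]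
    by_cases h : y ∈ Z
    · rw [show partition c δ a y = 0 from h, zero_mul]
    · simp [h]
  simp only [h2, integral_zero, mul_zero] at h1
  rw [integral_eq_zero_iff_of_nonneg
    (fun ω => Set.indicator_nonneg (fun _ _ => zero_le_one) _) hi] at h1
  filter_upwards [h1] with ω hω h
  have : observe c a ω ∈ Z := h
  simp [this] at hω

/-- Dropping a discrete observation costs at most `log 2`. -/
theorem freeEnergy_le_of_drop {c : A → Sym2 V} {c' : A' → Sym2 V} {j : A' → A}
    (hj : Function.Injective j) (hc : ∀ e, c (j e) = c' e) {δ : ℝ}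
    (hδ : δ ∈ Set.Icc (-1 : ℝ) 1) (a : Sym2 V → ℝ) :
    freeEnergy c δ a ≤ freeEnergy c' δ a +
      ((Fintype.card A : ℝ) - Fintype.card A') * Real.log 2 := by
  classical
  have := isProbabilityMeasure_drawLaw (V := V) (A := A) hδ
  have hc' : ∀ e, c (j e) = Sym2.map id (c' e) := fun e => by rw [hc, Sym2.map_id, id]
  obtain ⟨hI, hE⟩ := integral_restrict Function.injective_id hj hc' hδ a
  rw [Sym2.map_id, Function.comp_id] at hI hE
  have hcard : Fintype.card A' ≤ Fintype.card A := Fintype.card_le_of_injective j hj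
  set m := Fintype.card A - Fintype.card A' with hm
  have hm' : (Fintype.card A : ℝ) - Fintype.card A' = (m : ℝ) := by
    rw [hm, Nat.cast_sub hcard]
  -- Each of the `m` dropped factors is `1 + δ` or `1 - δ`, hence lies in `[0, 2]`.
  have hwt : ∀ σ k, wt c δ σ k ≤ 2 ^ m * wt c' δ σ (k ∘ j) := by
    intro σ k
    have hb : ∀ s : ℤˣ, 0 ≤ 1 + δ * ((s : ℤ) : ℝ) ∧ 1 + δ * ((s : ℤ) : ℝ) ≤ 2 := by
      intro s
      rcases Int.units_eq_one_or s with h | h <;> rw [h] <;> push_cast <;>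
        constructor <;> linarith [hδ.1, hδ.2]
    have h1 : wt c' δ σ (k ∘ j) = ∏ e ∈ Finset.univ.image j,
        (1 + δ * (((k e * pairSign σ (c e) : ℤˣ) : ℤ) : ℝ)) := by
      rw [Finset.prod_image fun x _ y _ h => hj h, wt]
      exact Finset.prod_congr rfl fun e _ => by rw [hc]; rfl
    have h2 : (Finset.univ.image j)ᶜ.card = m := by
      rw [Finset.card_compl, Finset.card_image_of_injective _ hj, Finset.card_univ]
    rw [h1, wt, ← Finset.prod_compl_mul_prod (Finset.univ.image j)]
    refine mul_le_mul_of_nonneg_right ?_ (Finset.prod_nonneg fun e _ => (hb _).1)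
    rw [← h2, ← Finset.prod_const]
    exact Finset.prod_le_prod (fun e _ => (hb _).1) (fun e _ => (hb _).2)
  have hZ : ∀ y, partition c δ a y ≤ 2 ^ m * partition c' δ a (restrictObs id j y) := by
    intro y
    rw [partition, partition, Finset.mul_sum]
    refine Finset.sum_le_sum fun σ _ => ?_
    rw [lik, lik, ← mul_assoc]
    refine mul_le_mul (hwt σ y.1) (le_of_eq ?_) (Real.exp_pos _).le
      (mul_nonneg (by positivity) (wt_nonneg c' hδ _ _))
    simp only [restrictObs, Sym2.map_id, Function.comp_id]
  rw [hm', hE]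
  have h3 : ∫ ω, Real.log (partition c δ a (observe c a ω)) ∂drawLaw V A δ ≤
      ∫ ω, (Real.log (partition c' δ a (restrictObs id j (observe c a ω))) + m * Real.log 2)
        ∂drawLaw V A δ := by
    refine integral_mono_ae (integrable_log_partition c hδ a a) (hI.add (integrable_const _)) ?_
    filter_upwards [ae_partition_ne_zero c hδ a] with ω hω
    have p1 := (partition_nonneg c hδ a _).lt_of_ne' hω
    have p2 : 0 < partition c' δ a (restrictObs id j (observe c a ω)) :=
      pos_of_mul_pos_right (p1.trans_le (hZ _)) (by positivity)
    refine (Real.log_le_log p1 (hZ _)).trans_eq ?_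
    rw [Real.log_mul (by positivity) p2.ne', Real.log_pow, add_comm]
  rw [integral_add hI (integrable_const _), integral_const, probReal_univ, one_smul] at h3
  exact h3

/-- Isomorphic systems have the same free energy. -/
theorem freeEnergy_congr {c : A → Sym2 V} {c' : A' → Sym2 V'} (i : V' ≃ V) (j : A' ≃ A)
    (hc : ∀ e, c (j e) = Sym2.map i (c' e)) {δ : ℝ} (hδ : δ ∈ Set.Icc (-1 : ℝ) 1)
    (a : Sym2 V → ℝ) :
    freeEnergy c' δ (a ∘ Sym2.map i) = freeEnergy c δ a := by
  rw [(integral_restrict i.injective j.injective hc hδ a).2, freeEnergy, crossEnergy]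
  congr 1
  funext ω
  congr 1
  set y := observe c a ω
  have hbij : Function.Bijective (Sym2.map i) := by
    refine ⟨Sym2.map.injective i.injective, fun e => ⟨Sym2.map i.symm e, ?_⟩⟩
    rw [Sym2.map_map]
    simp
  rw [partition, partition]
  refine Eq.trans (Finset.sum_congr rfl fun σ _ => ?_)
    (Equiv.sum_comp (i.arrowCongr (Equiv.refl ℤˣ)) _)
  have hσ : (i.arrowCongr (Equiv.refl ℤˣ)) σ ∘ i = σ := by
    funext u; simp [Equiv.arrowCongr]
  generalize (i.arrowCongr (Equiv.refl ℤˣ)) σ = τ at hσ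
  subst hσ
  rw [lik, lik]
  congr 1
  · rw [wt, wt, ← Equiv.prod_comp j]
    refine Finset.prod_congr rfl fun e _ => ?_
    rw [hc, pairSign_comp]
    rfl
  · congr 1
    rw [expo, expo, ← hbij.sum_comp]
    refine Finset.sum_congr rfl fun e _ => ?_
    rw [sgn_comp]
    rfl

theorem freeEnergy_amp_congr {c : A → Sym2 V} {c' : A' → Sym2 V'} (i : V' ≃ V) (j : A' ≃ A)
    (hc : ∀ e, c (j e) = Sym2.map i (c' e)) {δ : ℝ} (hδ : δ ∈ Set.Icc (-1 : ℝ) 1) (η : ℝ) :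
    freeEnergy c' δ (amp V' η) = freeEnergy c δ (amp V η) := by
  rw [← freeEnergy_congr i j hc hδ]
  congr 1
  funext e
  simp only [amp, Function.comp_apply, Fintype.card_congr i]

/-! ### Splitting a system into two independent parts -/

variable {S T AS AT : Type*} [Fintype S] [DecidableEq S] [Fintype T] [DecidableEq T]
  [Fintype AS] [Fintype AT]

/-- A negative semidefinite quadratic form is nonpositive on the squared posterior
correlations. -/
theorem sum_mul_overlap_nonpos (c : A → Sym2 V) {δ : ℝ} (hδ : δ ∈ Set.Icc (-1 : ℝ) 1)
    (a : Sym2 V → ℝ) {μ : V → V → ℝ} (hμ : ∀ r : V → ℝ, ∑ u, ∑ v, μ u v * (r u * r v) ≤ 0) :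
    ∑ u, ∑ v, μ u v * overlap c δ a s(u, v) ≤ 0 := by
  have := isProbabilityMeasure_drawLaw (V := V) (A := A) hδ
  have hpt : ∀ y, ∑ u, ∑ v, μ u v * gibbs c δ a (fun σ => sgn σ s(u, v)) y ^ 2 ≤ 0 := by
    intro y
    have hs : ∀ (σ : V → ℤˣ) u v, sgn σ s(u, v) = ((σ u : ℤ) : ℝ) * ((σ v : ℤ) : ℝ) := by
      intro σ u v; simp [sgn, pairSign]
    set w : (V → ℤˣ) → ℝ := fun σ => lik c δ a σ y / partition c δ a y with hw
    have hw0 : ∀ σ, 0 ≤ w σ := fun σ =>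
      div_nonneg (lik_nonneg c hδ a σ y) (partition_nonneg c hδ a y)
    have hg : ∀ u v, gibbs c δ a (fun σ => sgn σ s(u, v)) y =
        ∑ σ, w σ * (((σ u : ℤ) : ℝ) * ((σ v : ℤ) : ℝ)) := by
      intro u v
      rw [gibbs, Finset.sum_div]
      refine Finset.sum_congr rfl fun σ _ => ?_
      rw [hs, hw]
      ring
    -- The square of a posterior mean is a mean over two independent replicas `σ`, `τ`; the summand
    -- becomes the quadratic form at the vector `r u = σ u * τ u`.
    have h1 : ∑ u, ∑ v, μ u v * gibbs c δ a (fun σ => sgn σ s(u, v)) y ^ 2 =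
        ∑ σ, ∑ τ, w σ * w τ * ∑ u, ∑ v, μ u v *
          ((((σ u : ℤ) : ℝ) * ((τ u : ℤ) : ℝ)) * (((σ v : ℤ) : ℝ) * ((τ v : ℤ) : ℝ))) := by
      calc ∑ u, ∑ v, μ u v * gibbs c δ a (fun σ => sgn σ s(u, v)) y ^ 2
          = ∑ u, ∑ v, ∑ σ, ∑ τ, w σ * w τ * (μ u v *
          ((((σ u : ℤ) : ℝ) * ((τ u : ℤ) : ℝ)) * (((σ v : ℤ) : ℝ) * ((τ v : ℤ) : ℝ)))) := by
            refine Finset.sum_congr rfl fun u _ => Finset.sum_congr rfl fun v _ => ?_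
            rw [hg, sq, Finset.sum_mul_sum, Finset.mul_sum]
            refine Finset.sum_congr rfl fun σ _ => ?_
            rw [Finset.mul_sum]
            exact Finset.sum_congr rfl fun τ _ => by ring
        _ = ∑ u, ∑ σ, ∑ v, ∑ τ, w σ * w τ * (μ u v *
          ((((σ u : ℤ) : ℝ) * ((τ u : ℤ) : ℝ)) * (((σ v : ℤ) : ℝ) * ((τ v : ℤ) : ℝ)))) :=
            Finset.sum_congr rfl fun u _ => Finset.sum_comm
        _ = ∑ σ, ∑ u, ∑ τ, ∑ v, w σ * w τ * (μ u v *
          ((((σ u : ℤ) : ℝ) * ((τ u : ℤ) : ℝ)) * (((σ v : ℤ) : ℝ) * ((τ v : ℤ) : ℝ)))) := by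
            rw [Finset.sum_comm]
            exact Finset.sum_congr rfl fun σ _ => Finset.sum_congr rfl fun u _ => Finset.sum_comm
        _ = _ := by
            refine Finset.sum_congr rfl fun σ _ => ?_
            rw [Finset.sum_comm]
            refine Finset.sum_congr rfl fun τ _ => ?_
            simp only [Finset.mul_sum]
    rw [h1]
    exact Finset.sum_nonpos fun σ _ => Finset.sum_nonpos fun τ _ =>
      mul_nonpos_of_nonneg_of_nonpos (mul_nonneg (hw0 σ) (hw0 τ))
        (hμ fun u => ((σ u : ℤ) : ℝ) * ((τ u : ℤ) : ℝ))
  have hint : ∀ u v, Integrable (fun ω : Draw V A =>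
      μ u v * gibbs c δ a (fun σ => sgn σ s(u, v)) (observe c a ω) ^ 2) (drawLaw V A δ) := by
    intro u v
    refine Integrable.const_mul (Integrable.of_bound (C := 1)
      (((measurable_gibbs c δ a _).comp (measurable_observe c a)).pow_const 2).aestronglyMeasurable
      (ae_of_all _ fun ω => ?_)) _
    rw [Real.norm_eq_abs, abs_pow]
    exact pow_le_one₀ (abs_nonneg _) (abs_gibbs_sgn_le c hδ a _ _)
  have h2 : ∑ u, ∑ v, μ u v * overlap c δ a s(u, v) =
      ∫ ω, ∑ u, ∑ v, μ u v * gibbs c δ a (fun σ => sgn σ s(u, v)) (observe c a ω) ^ 2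
        ∂drawLaw V A δ := by
    rw [integral_finsetSum _ fun u _ => integrable_finsetSum _ fun v _ => hint u v]
    refine Finset.sum_congr rfl fun u _ => ?_
    rw [integral_finsetSum _ fun v _ => hint u v]
    refine Finset.sum_congr rfl fun v _ => ?_
    rw [integral_const_mul, overlap]
  rw [h2]
  exact integral_nonpos fun ω => hpt _

/-- The signal-to-noise ratios of two independent systems: `η / |S|` inside `S`, `η / |T|` inside
`T`, and `0` across. -/
def splitSNR (S T : Type*) [Fintype S] [Fintype T] (η : ℝ) : S ⊕ T → S ⊕ T → ℝ
  | Sum.inl _, Sum.inl _ => η / Fintype.card S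
  | Sum.inr _, Sum.inr _ => η / Fintype.card T
  | _, _ => 0

omit [DecidableEq S] [DecidableEq T] in
theorem splitSNR_comm (η : ℝ) (u v : S ⊕ T) : splitSNR S T η u v = splitSNR S T η v u := by
  cases u <;> cases v <;> rfl

theorem splitSNR_nonneg {η : ℝ} (hη : 0 ≤ η) (u v : S ⊕ T) : 0 ≤ splitSNR S T η u v := by
  cases u <;> cases v <;> simp only [splitSNR] <;> positivity

/-- `splitSNR` as a function of the unordered pair. -/
def splitSNR₂ (S T : Type*) [Fintype S] [Fintype T] (η : ℝ) : Sym2 (S ⊕ T) → ℝ :=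
  Sym2.lift ⟨splitSNR S T η, splitSNR_comm η⟩

theorem splitSNR₂_nonneg {η : ℝ} (hη : 0 ≤ η) (e : Sym2 (S ⊕ T)) : 0 ≤ splitSNR₂ S T η e := by
  induction e using Sym2.ind with
  | _ u v => exact splitSNR_nonneg hη u v

/-- Interpolation: the joint mean-field coupling has a smaller free energy than the split one. -/
theorem freeEnergy_le_split [Nonempty S] [Nonempty T] (c : A → Sym2 (S ⊕ T)) {δ : ℝ}
    (hδ : δ ∈ Set.Icc (-1 : ℝ) 1) {η : ℝ} (hη : 0 < η) :
    freeEnergy c δ (amp (S ⊕ T) η) ≤ freeEnergy c δ fun e => √(splitSNR₂ S T η e) := by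
  have hs : (0 : ℝ) < Fintype.card S := by exact_mod_cast Fintype.card_pos
  have ht : (0 : ℝ) < Fintype.card T := by exact_mod_cast Fintype.card_pos
  have hN : (Fintype.card (S ⊕ T) : ℝ) = Fintype.card S + Fintype.card T := by
    rw [Fintype.card_sum]; push_cast; rfl
  have hN0 : (0 : ℝ) < Fintype.card (S ⊕ T) := by rw [hN]; positivity
  -- The path is linear in the signal-to-noise ratios, not in the amplitudes: split at `t = 0`,
  -- joint at `t = 1`.
  set l : ℝ → Sym2 (S ⊕ T) → ℝ := fun t e =>
    (1 - t) * splitSNR₂ S T η e + t * (η / Fintype.card (S ⊕ T)) with hl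
  -- At `t = 0` the cross ratios vanish and the square root is not differentiable there; the
  -- endpoints are reached by continuity.
  have hpos : ∀ t ∈ Set.Ioo (0 : ℝ) 1, ∀ e, 0 < l t e := by
    intro t ht e
    have h1 := mul_nonneg (sub_nonneg.2 ht.2.le) (splitSNR₂_nonneg (S := S) (T := T) hη.le e)
    have h2 := mul_pos ht.1 (div_pos hη hN0)
    exact add_pos_of_nonneg_of_pos h1 h2
  have hcont : Continuous fun t => freeEnergy c δ fun e => √(l t e) := by
    refine (continuous_freeEnergy c hδ).comp (continuous_pi fun e => ?_)
    simp only [hl]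
    fun_prop
  have hder : ∀ t ∈ Set.Ioo (0 : ℝ) 1, HasDerivAt (fun t => freeEnergy c δ fun e => √(l t e))
      (∑ e, ((η / Fintype.card (S ⊕ T)) - splitSNR₂ S T η e) / 2 *
        overlap c δ (fun e => √(l t e)) e) t := by
    intro t ht
    have h1 : ∀ e, HasDerivAt (fun s => l s e)
        ((η / Fintype.card (S ⊕ T)) - splitSNR₂ S T η e) t := fun e => by
      refine ((((hasDerivAt_id t).const_sub 1).mul_const _).add
        ((hasDerivAt_id t).mul_const _)).congr_deriv ?_
      ring
    have h2 := hasDerivAt_freeEnergy c hδ (a := fun s e => √(l s e))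
      fun e => (h1 e).sqrt (hpos t ht e).ne'
    refine h2.congr_deriv (Finset.sum_congr rfl fun e _ => ?_)
    have : √(l t e) ≠ 0 := (Real.sqrt_pos.2 (hpos t ht e)).ne'
    field_simp
  have hneg : ∀ a : Sym2 (S ⊕ T) → ℝ,
      ∑ e, ((η / Fintype.card (S ⊕ T)) - splitSNR₂ S T η e) / 2 * overlap c δ a e ≤ 0 := by
    intro a
    have h1 := sum_sum_add_sum_diag fun e =>
      ((η / Fintype.card (S ⊕ T)) - splitSNR₂ S T η e) / 2 * overlap c δ a e
    have h2 : ∑ u, ∑ v, ((η / Fintype.card (S ⊕ T)) - splitSNR S T η u v) / 2 *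
        overlap c δ a s(u, v) ≤ 0 := by
      refine sum_mul_overlap_nonpos c hδ a fun r => ?_
      simp only [Fintype.sum_sum_type, splitSNR, hN]
      simp only [← Finset.mul_sum, ← Finset.sum_mul, Finset.sum_add_distrib]
      set P := ∑ x, r (Sum.inl x)
      set Q := ∑ x, r (Sum.inr x)
      -- Joint minus split coupling is minus a square: it only measures the difference between the
      -- averages of `r` over `S` and over `T`.
      have h3 : (η / (Fintype.card S + Fintype.card T) - η / Fintype.card S) / 2 * (P * P) +
          (η / (Fintype.card S + Fintype.card T) - 0) / 2 * (P * Q) +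
          ((η / (Fintype.card S + Fintype.card T) - 0) / 2 * (Q * P) +
          (η / (Fintype.card S + Fintype.card T) - η / Fintype.card T) / 2 * (Q * Q)) =
          - (η / (2 * (Fintype.card S * Fintype.card T * (Fintype.card S + Fintype.card T)))) *
            (Fintype.card T * P - Fintype.card S * Q) ^ 2 := by
        field_simp
        ring
      rw [h3]
      exact mul_nonpos_of_nonpos_of_nonneg (neg_nonpos.2 (by positivity)) (sq_nonneg _)
    -- The diagonal contributes `η/2` from the joint coupling and `-η/2` from each part, so it too
    -- has the favourable sign.
    have h4 : ∑ u : S ⊕ T, ((η / Fintype.card (S ⊕ T)) - splitSNR₂ S T η s(u, u)) / 2 *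
        overlap c δ a s(u, u) = - (η / 2) := by
      simp only [overlap_diag c hδ, mul_one, Fintype.sum_sum_type, splitSNR₂, Sym2.lift_mk,
        splitSNR, hN, Finset.sum_const, Finset.card_univ, nsmul_eq_mul]
      field_simp
      ring
    have h5 : ∑ u, ∑ v, ((η / Fintype.card (S ⊕ T)) - splitSNR₂ S T η s(u, v)) / 2 *
        overlap c δ a s(u, v) ≤ 0 := h2
    rw [h4] at h1
    linarith
  have hanti : AntitoneOn (fun t => freeEnergy c δ fun e => √(l t e)) (Set.Icc 0 1) := by
    refine antitoneOn_of_deriv_nonpos (convex_Icc 0 1) hcont.continuousOn ?_ ?_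
    · rw [interior_Icc]
      exact fun t ht => (hder t ht).differentiableAt.differentiableWithinAt
    · rw [interior_Icc]
      intro t ht
      rw [(hder t ht).deriv]
      exact hneg _
  have h := hanti (Set.left_mem_Icc.2 zero_le_one) (Set.right_mem_Icc.2 zero_le_one) zero_le_one
  have e0 : l 0 = splitSNR₂ S T η := by funext e; simp [hl]
  have e1 : l 1 = fun _ => η / Fintype.card (S ⊕ T) := by funext e; simp only [hl]; ring
  simp only [e0, e1] at h
  exact h

theorem sum_sym2_sum {F : Sym2 (S ⊕ T) → ℝ} (hF : ∀ x y, F s(Sum.inl x, Sum.inr y) = 0) :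
    ∑ e, F e = ∑ e, F (Sym2.map Sum.inl e) + ∑ e, F (Sym2.map Sum.inr e) := by
  have h := sum_sum_add_sum_diag F
  have hS := sum_sum_add_sum_diag fun e : Sym2 S => F (Sym2.map Sum.inl e)
  have hT := sum_sum_add_sum_diag fun e : Sym2 T => F (Sym2.map Sum.inr e)
  have hF' : ∀ x y, F s(Sum.inr y, Sum.inl x) = 0 := fun x y => by rw [Sym2.eq_swap, hF]
  simp only [Fintype.sum_sum_type, hF, hF', Finset.sum_const_zero, add_zero, zero_add] at h
  simp only [Sym2.map_mk] at hS hT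
  linarith

/-- Without couplings between the two parts, the partition function factorizes. -/
theorem partition_split (cS : AS → Sym2 S) (cT : AT → Sym2 T) (δ : ℝ) {a : Sym2 (S ⊕ T) → ℝ}
    (ha : ∀ x y, a s(Sum.inl x, Sum.inr y) = 0) (y : Obs (S ⊕ T) (AS ⊕ AT)) :
    partition (Sum.elim (Sym2.map Sum.inl ∘ cS) (Sym2.map Sum.inr ∘ cT)) δ a y =
      partition cS δ (a ∘ Sym2.map Sum.inl) (restrictObs Sum.inl Sum.inl y) *
      partition cT δ (a ∘ Sym2.map Sum.inr) (restrictObs Sum.inr Sum.inr y) := by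
  rw [partition, partition, partition, Finset.sum_mul_sum, ← Fintype.sum_prod_type',
    ← Equiv.sum_comp (Equiv.sumArrowEquivProdArrow S T ℤˣ)]
  refine Finset.sum_congr rfl fun σ _ => ?_
  have e1 : ((Equiv.sumArrowEquivProdArrow S T ℤˣ) σ).1 = σ ∘ Sum.inl := rfl
  have e2 : ((Equiv.sumArrowEquivProdArrow S T ℤˣ) σ).2 = σ ∘ Sum.inr := rfl
  rw [e1, e2, lik, lik, lik, mul_mul_mul_comm, ← Real.exp_add]
  congr 1
  · rw [wt, wt, wt, Fintype.prod_sum_type]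
    congr 1 <;>
    · refine Finset.prod_congr rfl fun e _ => ?_
      rw [pairSign_comp]
      rfl
  · congr 1
    rw [expo, expo, expo, sum_sym2_sum fun x y => by rw [ha]; ring]
    congr 1 <;>
    · refine Finset.sum_congr rfl fun e _ => ?_
      rw [sgn_comp]
      rfl

theorem freeEnergy_split (cS : AS → Sym2 S) (cT : AT → Sym2 T) {δ : ℝ}
    (hδ : δ ∈ Set.Icc (-1 : ℝ) 1) {a : Sym2 (S ⊕ T) → ℝ}
    (ha : ∀ x y, a s(Sum.inl x, Sum.inr y) = 0) :
    freeEnergy (Sum.elim (Sym2.map Sum.inl ∘ cS) (Sym2.map Sum.inr ∘ cT)) δ a =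
      freeEnergy cS δ (a ∘ Sym2.map Sum.inl) + freeEnergy cT δ (a ∘ Sym2.map Sum.inr) := by
  obtain ⟨iS, eS⟩ := integral_restrict
    (c := Sum.elim (Sym2.map Sum.inl ∘ cS) (Sym2.map Sum.inr ∘ cT)) (c' := cS)
    (i := Sum.inl) (j := Sum.inl) Sum.inl_injective Sum.inl_injective (fun _ => rfl) hδ a
  obtain ⟨iT, eT⟩ := integral_restrict
    (c := Sum.elim (Sym2.map Sum.inl ∘ cS) (Sym2.map Sum.inr ∘ cT)) (c' := cT)
    (i := Sum.inr) (j := Sum.inr) Sum.inr_injective Sum.inr_injective (fun _ => rfl) hδ a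
  rw [eS, eT, ← integral_add iS iT, freeEnergy, crossEnergy]
  refine integral_congr_ae ?_
  filter_upwards [ae_partition_ne_zero (Sum.elim (Sym2.map Sum.inl ∘ cS) (Sym2.map Sum.inr ∘ cT))
    hδ a] with ω hω
  rw [partition_split cS cT δ ha] at hω ⊢
  exact Real.log_mul (left_ne_zero_of_mul hω) (right_ne_zero_of_mul hω)

/-- Subadditivity of the free energy. -/
theorem freeEnergy_sum_le [Nonempty S] [Nonempty T] {c : A → Sym2 (S ⊕ T)} {cS : AS → Sym2 S}
    {cT : AT → Sym2 T} {j : AS ⊕ AT → A} (hj : Function.Injective j)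
    (hcS : ∀ e, c (j (Sum.inl e)) = Sym2.map Sum.inl (cS e))
    (hcT : ∀ e, c (j (Sum.inr e)) = Sym2.map Sum.inr (cT e)) {δ : ℝ}
    (hδ : δ ∈ Set.Icc (-1 : ℝ) 1) {η : ℝ} (hη : 0 < η) :
    freeEnergy c δ (amp (S ⊕ T) η) - Fintype.card A * Real.log 2 ≤
      (freeEnergy cS δ (amp S η) - Fintype.card AS * Real.log 2) +
      (freeEnergy cT δ (amp T η) - Fintype.card AT * Real.log 2) := by
  -- Discrete observations across the cut go first; the correction `-|A| log 2` pays for them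
  -- exactly. The Gaussian couplings across are then removed by interpolation.
  have h1 := freeEnergy_le_of_drop hj
    (c' := Sum.elim (Sym2.map Sum.inl ∘ cS) (Sym2.map Sum.inr ∘ cT))
    (by rintro (e | e); exacts [hcS e, hcT e]) hδ (amp (S ⊕ T) η)
  have h2 := freeEnergy_le_split (Sum.elim (Sym2.map Sum.inl ∘ cS) (Sym2.map Sum.inr ∘ cT)) hδ hη
  have h3 := freeEnergy_split cS cT hδ (a := fun e => √(splitSNR₂ S T η e))
    fun x y => by simp [splitSNR₂, splitSNR]
  have eS : (fun e => √(splitSNR₂ S T η e)) ∘ Sym2.map Sum.inl = amp S η := by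
    funext e
    induction e using Sym2.ind with
    | _ u v => rfl
  have eT : (fun e => √(splitSNR₂ S T η e)) ∘ Sym2.map Sum.inr = amp T η := by
    funext e
    induction e using Sym2.ind with
    | _ u v => rfl
  rw [eS, eT] at h3
  rw [Fintype.card_sum] at h1
  push_cast at h1
  linarith

/-! ### Limits of derivatives of convex functions -/

/-- If convex functions converge pointwise, their derivatives converge off a countable set. -/
theorem countable_not_tendsto_deriv {h φ : ℕ → ℝ → ℝ}
    (hd : ∀ n, ∀ x, 0 < x → HasDerivAt (h n) (φ n x) x)
    (hmono : ∀ n, MonotoneOn (φ n) (Set.Ioi 0)) {M : ℝ} (h0 : ∀ n x, 0 ≤ φ n x)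
    (hM : ∀ n x, φ n x ≤ M) (hl : ∀ x, 0 < x → ∃ l, Tendsto (fun n => h n x) atTop (𝓝 l)) :
    {x : ℝ | 0 < x ∧ ¬∃ l, Tendsto (fun n => φ n x) atTop (𝓝 l)}.Countable := by
  have bA : ∀ x, IsBoundedUnder (· ≤ ·) atTop fun n => φ n x := fun x =>
    isBoundedUnder_of ⟨M, fun n => hM n x⟩
  have bB : ∀ x, IsBoundedUnder (· ≥ ·) atTop fun n => φ n x := fun x =>
    isBoundedUnder_of ⟨0, fun n => h0 n x⟩
  -- The slope of `h n` over `[a, b]` lies between `φ n a` and `φ n b`, and the slopes converge;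
  -- this separates the upper limit at `a` from the lower limit at `b`.
  have key : ∀ a b, 0 < a → a < b →
      limsup (fun n => φ n a) atTop ≤ liminf (fun n => φ n b) atTop := by
    intro a b ha hab
    obtain ⟨la, hla⟩ := hl a ha
    obtain ⟨lb, hlb⟩ := hl b (ha.trans hab)
    have hκ : Tendsto (fun n => (h n b - h n a) / (b - a)) atTop (𝓝 ((lb - la) / (b - a))) :=
      (hlb.sub hla).div_const _
    have hmvt : ∀ n, φ n a ≤ (h n b - h n a) / (b - a) ∧
        (h n b - h n a) / (b - a) ≤ φ n b := by
      intro n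
      obtain ⟨x, hx, hxe⟩ := exists_hasDerivAt_eq_slope (h n) (φ n) hab
        (fun y hy => (hd n y (ha.trans_le hy.1)).continuousAt.continuousWithinAt)
        (fun y hy => hd n y (ha.trans hy.1))
      rw [← hxe]
      exact ⟨hmono n ha (ha.trans hx.1) hx.1.le, hmono n (ha.trans hx.1) (ha.trans hab) hx.2.le⟩
    calc limsup (fun n => φ n a) atTop
        ≤ limsup (fun n => (h n b - h n a) / (b - a)) atTop :=
          limsup_le_limsup (Eventually.of_forall fun n => (hmvt n).1) (bB a).isCoboundedUnder_le
            hκ.isBoundedUnder_le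
      _ = liminf (fun n => (h n b - h n a) / (b - a)) atTop := by
          rw [hκ.limsup_eq, hκ.liminf_eq]
      _ ≤ liminf (fun n => φ n b) atTop :=
          liminf_le_liminf (Eventually.of_forall fun n => (hmvt n).2) hκ.isBoundedUnder_ge
            (bA b).isCoboundedUnder_ge
  -- Each bad point carries the nonempty open interval between lower and upper limit. By `key` these
  -- intervals are disjoint, so there are countably many.
  refine Set.PairwiseDisjoint.countable_of_isOpen
    (s := fun x => Set.Ioo (liminf (fun n => φ n x) atTop) (limsup (fun n => φ n x) atTop))
    ?_ (fun _ _ => isOpen_Ioo) ?_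
  · have hlt : ∀ x y, 0 < x → x < y → Disjoint
        (Set.Ioo (liminf (fun n => φ n x) atTop) (limsup (fun n => φ n x) atTop))
        (Set.Ioo (liminf (fun n => φ n y) atTop) (limsup (fun n => φ n y) atTop)) := by
      intro x y hx hxy
      refine Set.disjoint_left.2 fun z hz hz' => ?_
      exact absurd (hz.2.trans_le (key x y hx hxy)) hz'.1.not_gt
    intro x hx y hy hne
    rcases lt_or_gt_of_ne hne with h | h
    · exact hlt x y hx.1 h
    · exact (hlt y x hy.1 h).symm
  · rintro x ⟨hx, hx'⟩
    refine Set.nonempty_Ioo.2 (lt_of_le_of_ne (liminf_le_limsup (bA x) (bB x)) fun heq => hx' ?_)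
    exact ⟨_, tendsto_of_liminf_eq_limsup rfl heq.symm (bA x) (bB x)⟩

/-! ### Subadditive functions of finite subsets of the lattice -/

theorem le_sum_of_subadditive {α ι : Type*} [DecidableEq α] {g : Finset α → ℝ}
    (h0 : g ∅ ≤ 0)
    (hsub : ∀ S T, Disjoint S T → g (S ∪ T) ≤ g S + g T) (s : Finset ι) (f : ι → Finset α)
    (hf : (s : Set ι).PairwiseDisjoint f) : g (s.biUnion f) ≤ ∑ i ∈ s, g (f i) := by
  classical
  induction s using Finset.induction_on with
  | empty => simpa using h0
  | insert i s hi ih =>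
    rw [Finset.biUnion_insert, Finset.sum_insert hi]
    have hd : Disjoint (f i) (s.biUnion f) := by
      rw [Finset.disjoint_biUnion_right]
      intro k hk
      exact hf (by simp) (by simp [hk]) (by rintro rfl; exact hi hk)
    refine (hsub _ _ hd).trans (add_le_add le_rfl (ih (hf.subset ?_)))
    simp

theorem mem_box {d n : ℕ} {x : Fin d → ℤ} : x ∈ box d n ↔ ∀ i, -(n : ℤ) ≤ x i ∧ x i ≤ n := by
  simp [box, Pi.le_def, forall_and]

/-- Tiling a box by translates of a smaller box. -/
theorem subadditive_box_le {d : ℕ} {g : Finset (Fin d → ℤ) → ℝ} (h0 : g ∅ ≤ 0)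
    (hsub : ∀ S T, Disjoint S T → g (S ∪ T) ≤ g S + g T)
    (htr : ∀ S t, g (S.map (addRightEmbedding t)) = g S) {c : ℝ} (hc : g {0} ≤ c) (m n : ℕ) :
    g (box d n) ≤ (((2 * n + 1) / (2 * m + 1) : ℕ) : ℝ) ^ d * g (box d m) +
      ((2 * n + 1 : ℝ) ^ d -
        (((2 * n + 1) / (2 * m + 1) : ℕ) : ℝ) ^ d * (2 * m + 1 : ℝ) ^ d) * c := by
  classical
  set k := (2 * n + 1) / (2 * m + 1) with hk
  have hkL : (2 * m + 1) * k ≤ 2 * n + 1 := Nat.mul_div_le _ _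
  -- The shift places the lowest corner of cell `j` at `(2m+1) j - n`, so the tiling starts at the
  -- lowest corner of the large box.
  set t : (Fin d → Fin k) → Fin d → ℤ := fun j i => (2 * m + 1) * ((j i : ℕ) : ℤ) + m - n with ht
  set cell : (Fin d → Fin k) → Finset (Fin d → ℤ) :=
    fun j => (box d m).map (addRightEmbedding (t j)) with hcell
  have hmem : ∀ j x, x ∈ cell j ↔ ∀ i, (2 * (m : ℤ) + 1) * ((j i : ℕ) : ℤ) ≤ x i + n ∧
      x i + n < (2 * (m : ℤ) + 1) * ((j i : ℕ) : ℤ) + (2 * m + 1) := by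
    intro j x
    simp only [hcell, Finset.mem_map, addRightEmbedding_apply, mem_box]
    constructor
    · rintro ⟨y, hy, rfl⟩ i
      have := hy i
      simp only [Pi.add_apply, ht]
      constructor <;> linarith
    · intro h
      refine ⟨x - t j, fun i => ?_, sub_add_cancel _ _⟩
      have := h i
      simp only [Pi.sub_apply, ht]
      constructor <;> linarith
  have hdisj : ((Finset.univ : Finset (Fin d → Fin k)) : Set (Fin d → Fin k)).PairwiseDisjoint
      cell := by
    intro j _ j' _ hne
    refine Finset.disjoint_left.2 fun x hx hx' => hne ?_
    rw [hmem] at hx hx'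
    funext i
    have h1 := hx i
    have h2 := hx' i
    have hL : (0 : ℤ) < 2 * m + 1 := by positivity
    have a1 : ((j i : ℕ) : ℤ) < ((j' i : ℕ) : ℤ) + 1 := by
      refine lt_of_mul_lt_mul_left ?_ hL.le
      linarith
    have a2 : ((j' i : ℕ) : ℤ) < ((j i : ℕ) : ℤ) + 1 := by
      refine lt_of_mul_lt_mul_left ?_ hL.le
      linarith
    exact Fin.ext (by omega)
  set U := Finset.univ.biUnion cell with hU
  have hUsub : U ⊆ box d n := by
    intro x hx
    obtain ⟨j, -, hj⟩ := Finset.mem_biUnion.1 hx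
    rw [hmem] at hj
    rw [mem_box]
    intro i
    obtain ⟨h1, h2⟩ := hj i
    have h3 : ((j i : ℕ) : ℤ) + 1 ≤ k := by have := (j i).2; omega
    have h4 : (2 * (m : ℤ) + 1) * (((j i : ℕ) : ℤ) + 1) ≤ (2 * m + 1) * k :=
      mul_le_mul_of_nonneg_left h3 (by positivity)
    have h5 : (2 * (m : ℤ) + 1) * k ≤ 2 * n + 1 := by exact_mod_cast hkL
    have h6 : (0 : ℤ) ≤ (2 * m + 1) * ((j i : ℕ) : ℤ) := by positivity
    constructor <;> linarith
  have hgU : g U ≤ (k : ℝ) ^ d * g (box d m) := by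
    refine (le_sum_of_subadditive h0 hsub _ cell hdisj).trans_eq ?_
    simp only [hcell, htr, Finset.sum_const, nsmul_eq_mul, Finset.card_univ, Fintype.card_pi,
      Fintype.card_fin, Finset.prod_const]
    push_cast
    rfl
  have hsingle : ∀ x, g {x} ≤ c := by
    intro x
    have := htr {0} x
    simp only [Finset.map_singleton, addRightEmbedding_apply, zero_add] at this
    rw [this]
    exact hc
  -- Sites not covered by cells are treated as singletons.
  have hrest : g (box d n \ U) ≤ ((box d n \ U).card : ℝ) * c := by
    have h1 := le_sum_of_subadditive h0 hsub (box d n \ U) (fun x => {x})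
      (fun x _ y _ hxy => by simpa using hxy)
    rw [Finset.biUnion_singleton_eq_self] at h1
    refine h1.trans ((Finset.sum_le_sum fun x _ => hsingle x).trans_eq ?_)
    rw [Finset.sum_const, nsmul_eq_mul]
  have hcardU : (U.card : ℝ) = (k : ℝ) ^ d * (2 * m + 1 : ℝ) ^ d := by
    rw [hU, Finset.card_biUnion fun x hx y hy hxy => hdisj hx hy hxy]
    simp only [hcell, Finset.card_map, card_box, Finset.sum_const, smul_eq_mul, Finset.card_univ,
      Fintype.card_pi, Fintype.card_fin, Finset.prod_const]
    push_cast
    rfl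
  have hcard : ((box d n \ U).card : ℝ) =
      (2 * n + 1 : ℝ) ^ d - (k : ℝ) ^ d * (2 * m + 1 : ℝ) ^ d := by
    rw [Finset.card_sdiff_of_subset hUsub, Nat.cast_sub (Finset.card_le_card hUsub), hcardU,
      card_box]
    push_cast
    rfl
  have h1 := hsub U (box d n \ U) Finset.disjoint_sdiff
  rw [Finset.union_sdiff_of_subset hUsub] at h1
  rw [hcard] at hrest
  linarith

/-- The last step of Fekete's argument: the upper limit is at most every term, hence at most the
infimum. -/
theorem tendsto_of_forall_eventually_le {x : ℕ → ℝ} (hb : BddBelow (Set.range x))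
    (h : ∀ m, ∀ ε > 0, ∀ᶠ n in atTop, x n ≤ x m + ε) : Tendsto x atTop (𝓝 (⨅ n, x n)) := by
  refine tendsto_order.2 ⟨fun a ha => Eventually.of_forall fun n => ha.trans_le (ciInf_le hb n),
    fun a ha => ?_⟩
  obtain ⟨m, hm⟩ := exists_lt_of_ciInf_lt ha
  filter_upwards [h m ((a - x m) / 2) (by linarith)] with n hn
  linarith

/-- Subadditive, translation invariant functions of finite subsets of the lattice have a density
along boxes. -/
theorem exists_tendsto_box_of_subadditive {d : ℕ} {g : Finset (Fin d → ℤ) → ℝ} (h0 : g ∅ ≤ 0)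
    (hsub : ∀ S T, Disjoint S T → g (S ∪ T) ≤ g S + g T)
    (htr : ∀ S t, g (S.map (addRightEmbedding t)) = g S) {C : ℝ}
    (hlow : ∀ S, - (C * S.card) ≤ g S) :
    ∃ l, Tendsto (fun n => g (box d n) / (2 * n + 1 : ℝ) ^ d) atTop (𝓝 l) := by
  refine ⟨_, tendsto_of_forall_eventually_le ⟨-C, ?_⟩ fun m ε hε => ?_⟩
  · rintro _ ⟨n, rfl⟩
    have h1 := hlow (box d n)
    rw [card_box] at h1
    push_cast at h1
    rw [le_div_iff₀ (by positivity)]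
    linarith
  -- The fraction of the large box covered by tiles of size `2m+1`; it tends to one, so the
  -- uncovered sites do not affect the density.
  · set ρ : ℕ → ℝ := fun n =>
      ((((2 * n + 1) / (2 * m + 1) : ℕ) : ℝ) * (2 * m + 1) / (2 * n + 1)) ^ d with hρ
    have hlim : Tendsto (fun n : ℕ => (((2 * n + 1) / (2 * m + 1) : ℕ) : ℝ) * (2 * m + 1) /
        (2 * n + 1)) atTop (𝓝 1) := by
      have hsm : Tendsto (fun n : ℕ => 1 - (2 * m + 1 : ℝ) / (2 * n + 1)) atTop (𝓝 (1 - 0)) := by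
        refine tendsto_const_nhds.sub (tendsto_const_nhds.div_atTop ?_)
        exact tendsto_atTop_add_const_right _ _
          (tendsto_natCast_atTop_atTop.const_mul_atTop (by norm_num))
      rw [sub_zero] at hsm
      refine tendsto_of_tendsto_of_tendsto_of_le_of_le hsm tendsto_const_nhds (fun n => ?_)
        fun n => ?_
      · have h1 : 2 * n + 1 < ((2 * n + 1) / (2 * m + 1) + 1) * (2 * m + 1) := by
          rw [mul_comm ((2 * n + 1) / (2 * m + 1) + 1)]
          exact Nat.lt_mul_div_succ _ (Nat.succ_pos (2 * m))
        have h2 : (2 * n + 1 : ℝ) <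
            ((((2 * n + 1) / (2 * m + 1) : ℕ) : ℝ) + 1) * (2 * m + 1) := by exact_mod_cast h1
        simp only
        rw [sub_le_iff_le_add, ← add_div, le_div_iff₀ (by positivity)]
        linarith
      · have h1 : (2 * n + 1) / (2 * m + 1) * (2 * m + 1) ≤ 2 * n + 1 := Nat.div_mul_le_self _ _
        have h2 : (((2 * n + 1) / (2 * m + 1) : ℕ) : ℝ) * (2 * m + 1) ≤ 2 * n + 1 := by
          exact_mod_cast h1
        exact div_le_one_of_le₀ h2 (by positivity)
    have hlimρ : Tendsto ρ atTop (𝓝 1) := by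
      have := hlim.pow d
      rwa [one_pow] at this
    have hfin : Tendsto (fun n => ρ n * (g (box d m) / (2 * m + 1 : ℝ) ^ d) + (1 - ρ n) * g {0})
        atTop (𝓝 (1 * (g (box d m) / (2 * m + 1 : ℝ) ^ d) + (1 - 1) * g {0})) :=
      (hlimρ.mul_const _).add ((tendsto_const_nhds.sub hlimρ).mul_const _)
    rw [one_mul, sub_self, zero_mul, add_zero] at hfin
    filter_upwards [hfin.eventually_lt_const (lt_add_of_pos_right _ hε)] with n hn
    refine le_trans ?_ hn.le
    have h1 := subadditive_box_le h0 hsub htr (le_refl (g {0})) m n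
    rw [div_le_iff₀ (by positivity)]
    refine h1.trans_eq ?_
    simp only [hρ, div_pow, mul_pow]
    have hm : (2 * m + 1 : ℝ) ^ d ≠ 0 := by positivity
    have hn : (2 * n + 1 : ℝ) ^ d ≠ 0 := by positivity
    field_simp

/-! ### The free energy of a region of the lattice -/

/-- The nearest-neighbour graph of the lattice. -/
def latGraph (d : ℕ) : SimpleGraph (Fin d → ℤ) where
  Adj u v := ∑ i, (u i - v i) ^ 2 = 1
  symm := ⟨fun u v h => by
    rw [← h]
    exact Finset.sum_congr rfl fun i _ => by ring⟩
  loopless := ⟨fun u h => by simp at h⟩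

/-- The graph induced by the lattice on a finite set of sites. -/
abbrev regionGraph {d : ℕ} (S : Finset (Fin d → ℤ)) : SimpleGraph S :=
  (latGraph d).comap (Subtype.val : S → Fin d → ℤ)

instance instFintypeEdgeSet {W : Type*} [Finite W] (G : SimpleGraph W) : Fintype G.edgeSet :=
  Fintype.ofFinite _

/-- The free energy of a system whose discrete observations are the edges of a graph, corrected so
as to be subadditive. -/
def graphEnergy {W : Type*} [Fintype W] [DecidableEq W] (G : SimpleGraph W) (δ η : ℝ) : ℝ :=
  freeEnergy (fun e : G.edgeSet => e.1) δ (amp W η) - Fintype.card G.edgeSet * Real.log 2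

theorem graphEnergy_congr {W W' : Type*} [Fintype W] [DecidableEq W] [Fintype W']
    [DecidableEq W'] {G : SimpleGraph W} {G' : SimpleGraph W'} (i : G' ≃g G) {δ : ℝ}
    (hδ : δ ∈ Set.Icc (-1 : ℝ) 1) (η : ℝ) : graphEnergy G' δ η = graphEnergy G δ η := by
  rw [graphEnergy, graphEnergy, freeEnergy_amp_congr (c := fun e : G.edgeSet => e.1)
    (c' := fun e : G'.edgeSet => e.1) i.toEquiv i.mapEdgeSet (fun _ => rfl) hδ,
    Fintype.card_congr i.mapEdgeSet]

theorem graphEnergy_sum_le {W W' : Type*} [Fintype W] [DecidableEq W] [Fintype W']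
    [DecidableEq W'] [Nonempty W] [Nonempty W'] {G : SimpleGraph (W ⊕ W')} {δ : ℝ}
    (hδ : δ ∈ Set.Icc (-1 : ℝ) 1) {η : ℝ} (hη : 0 < η) :
    graphEnergy G δ η ≤ graphEnergy (G.comap Sum.inl) δ η + graphEnergy (G.comap Sum.inr) δ η := by
  let jl : G.comap (Sum.inl : W → W ⊕ W') ↪g G :=
    SimpleGraph.Embedding.comap ⟨_, Sum.inl_injective⟩ G
  let jr : G.comap (Sum.inr : W' → W ⊕ W') ↪g G :=
    SimpleGraph.Embedding.comap ⟨_, Sum.inr_injective⟩ G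
  refine freeEnergy_sum_le (j := Sum.elim jl.mapEdgeSet jr.mapEdgeSet) ?_ (fun _ => rfl)
    (fun _ => rfl) hδ hη
  refine Function.Injective.sumElim jl.mapEdgeSet.injective jr.mapEdgeSet.injective ?_
  rintro ⟨x, hx⟩ ⟨y, hy⟩ h
  have h2 : Sym2.map (Sum.inl : W → W ⊕ W') x = Sym2.map Sum.inr y := congrArg Subtype.val h
  induction x using Sym2.ind with
  | _ u v =>
    induction y using Sym2.ind with
    | _ u' v' => simp at h2

/-- The corrected free energy of a region. -/
def regionEnergy {d : ℕ} (δ η : ℝ) (S : Finset (Fin d → ℤ)) : ℝ :=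
  graphEnergy (regionGraph S) δ η

theorem regionEnergy_map {d : ℕ} {δ : ℝ} (hδ : δ ∈ Set.Icc (-1 : ℝ) 1) (η : ℝ)
    (S : Finset (Fin d → ℤ)) (t : Fin d → ℤ) :
    regionEnergy δ η (S.map (addRightEmbedding t)) = regionEnergy δ η S := by
  have hb : Function.Bijective fun u : S =>
      (⟨u.1 + t, Finset.mem_map_of_mem (addRightEmbedding t) u.2⟩ :
        S.map (addRightEmbedding t)) := by
    refine ⟨fun u v h => Subtype.ext (add_right_cancel (congrArg Subtype.val h)), ?_⟩
    rintro ⟨x, hx⟩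
    obtain ⟨y, hy, rfl⟩ := Finset.mem_map.1 hx
    exact ⟨⟨y, hy⟩, rfl⟩
  refine (graphEnergy_congr ⟨Equiv.ofBijective _ hb, ?_⟩ hδ η).symm
  intro u v
  simp [latGraph]

theorem regionEnergy_union_le {d : ℕ} {δ : ℝ} (hδ : δ ∈ Set.Icc (-1 : ℝ) 1) {η : ℝ} (hη : 0 < η)
    {S T : Finset (Fin d → ℤ)} (hST : Disjoint S T) (hS : S.Nonempty) (hT : T.Nonempty) :
    regionEnergy δ η (S ∪ T) ≤ regionEnergy δ η S + regionEnergy δ η T := by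
  have := hS.to_subtype
  have := hT.to_subtype
  let i := Equiv.Finset.union S T hST
  have h1 := graphEnergy_congr (SimpleGraph.Iso.comap i (regionGraph (S ∪ T))) hδ η
  have h2 := graphEnergy_sum_le (G := (regionGraph (S ∪ T)).comap i) hδ hη
  rw [h1] at h2
  exact h2

/-- There is one configuration, of weight one. This case completes subadditivity, since the
interpolation needs both parts nonempty. -/
theorem regionEnergy_empty {d : ℕ} {δ : ℝ} (hδ : δ ∈ Set.Icc (-1 : ℝ) 1) (η : ℝ) :
    regionEnergy δ η (∅ : Finset (Fin d → ℤ)) = 0 := by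
  have := isProbabilityMeasure_drawLaw (V := (∅ : Finset (Fin d → ℤ)))
    (A := (regionGraph (∅ : Finset (Fin d → ℤ))).edgeSet) hδ
  have hV : IsEmpty (∅ : Finset (Fin d → ℤ)) := Finset.isEmpty_coe_sort.2 rfl
  have hE : IsEmpty (Sym2 (∅ : Finset (Fin d → ℤ))) := by
    refine ⟨fun e => ?_⟩
    induction e using Sym2.ind with
    | _ u v => exact hV.elim u
  have hA : IsEmpty (regionGraph (∅ : Finset (Fin d → ℤ))).edgeSet := ⟨fun e => hE.elim e.1⟩
  simp [regionEnergy, graphEnergy, freeEnergy, crossEnergy, partition, lik, wt, expo]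

/-- An edge is recovered from a chosen endpoint and the difference of its ends, which lies in the
box of radius 1. Only linearity in `S.card` matters: it bounds the energy density below. -/
theorem card_edgeSet_regionGraph_le {d : ℕ} (S : Finset (Fin d → ℤ)) :
    Fintype.card (regionGraph S).edgeSet ≤ S.card * (2 * 1 + 1) ^ d := by
  have hadj : ∀ e : (regionGraph S).edgeSet,
      (regionGraph S).Adj (Quot.out e.1).1 (Quot.out e.1).2 := by
    intro e
    have h := e.2
    rw [← Quot.out_eq e.1] at h
    exact h
  have hbox : ∀ e : (regionGraph S).edgeSet,
      (Quot.out e.1).1.1 - (Quot.out e.1).2.1 ∈ box d 1 := by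
    intro e
    have h : ∑ i, ((Quot.out e.1).1.1 i - (Quot.out e.1).2.1 i) ^ 2 = 1 := hadj e
    rw [mem_box]
    intro i
    have h1 := Finset.single_le_sum (f := fun i =>
      ((Quot.out e.1).1.1 i - (Quot.out e.1).2.1 i) ^ 2) (fun i _ => sq_nonneg _)
      (Finset.mem_univ i)
    rw [h] at h1
    have h2 := abs_le.1 (sq_le_one_iff_abs_le_one _ |>.1 h1)
    simpa using h2
  have hcard : Fintype.card (S × box d 1) = S.card * (2 * 1 + 1) ^ d := by
    rw [Fintype.card_prod, Fintype.card_coe, Fintype.card_coe, card_box]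
  rw [← hcard]
  refine Fintype.card_le_of_injective
    (fun e : (regionGraph S).edgeSet => ((Quot.out e.1).1, (⟨_, hbox e⟩ : box d 1))) ?_
  intro e e' h
  simp only [Prod.mk.injEq, Subtype.mk.injEq] at h
  obtain ⟨h1, h2⟩ := h
  rw [h1] at h2
  have h3 : (Quot.out e.1).2 = (Quot.out e'.1).2 := Subtype.ext (sub_right_injective h2)
  refine Subtype.ext ?_
  rw [← Quot.out_eq e.1, ← Quot.out_eq e'.1, Prod.ext h1 h3]

theorem neg_le_regionEnergy {d : ℕ} {δ : ℝ} (hδ : δ ∈ Set.Icc (-1 : ℝ) 1) (η : ℝ)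
    (S : Finset (Fin d → ℤ)) :
    -((2 * 1 + 1) ^ d * Real.log 2 * S.card) ≤ regionEnergy δ η S := by
  have h1 := freeEnergy_nonneg (fun e : (regionGraph S).edgeSet => e.1) hδ (amp S η)
  have h2 : (Fintype.card (regionGraph S).edgeSet : ℝ) ≤ S.card * (2 * 1 + 1) ^ d := by
    exact_mod_cast card_edgeSet_regionGraph_le S
  have h3 := mul_le_mul_of_nonneg_right h2 (Real.log_nonneg one_le_two)
  rw [regionEnergy, graphEnergy]
  linarith

theorem exists_tendsto_regionEnergy (d : ℕ) {δ : ℝ} (hδ : δ ∈ Set.Icc (-1 : ℝ) 1) {η : ℝ}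
    (hη : 0 < η) :
    ∃ l, Tendsto (fun n => regionEnergy δ η (box d n) / (2 * n + 1 : ℝ) ^ d) atTop (𝓝 l) := by
  have h0 := regionEnergy_empty (d := d) hδ η
  refine exists_tendsto_box_of_subadditive h0.le (fun S T hST => ?_) (regionEnergy_map hδ η)
    (neg_le_regionEnergy hδ η)
  rcases S.eq_empty_or_nonempty with rfl | hS
  · rw [Finset.empty_union, h0, zero_add]
  rcases T.eq_empty_or_nonempty with rfl | hT
  · rw [Finset.union_empty, h0, add_zero]
  exact regionEnergy_union_le hδ hη hST hS hT

/-! ### Conclusion -/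

theorem pairCorr_mono (d n : ℕ) {δ δ' η η' : ℝ} (h0 : 0 ≤ δ') (hδ : δ' ≤ δ) (h1 : δ ≤ 1)
    (hη0 : 0 ≤ η') (hη : η' ≤ η) : pairCorr d n δ' η' ≤ pairCorr d n δ η := by
  rw [pairCorr_eq d n ⟨by linarith, by linarith⟩, pairCorr_eq d n ⟨by linarith, h1⟩]
  exact meanOverlap_mono _ h0 hδ h1 hη0 hη

theorem pairCorr_nonneg (d n : ℕ) (δ η : ℝ) : 0 ≤ pairCorr d n δ η :=
  mul_nonneg (by positivity) (Finset.sum_nonneg fun _ _ => Finset.sum_nonneg fun _ _ =>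
    integral_nonneg fun _ => sq_nonneg _)

theorem hasDerivAt_regionEnergy_box (d n : ℕ) {δ : ℝ} (hδ : δ ∈ Set.Icc (-1 : ℝ) 1) {η : ℝ}
    (hη : 0 < η) :
    HasDerivAt (fun s => regionEnergy δ s (box d n) / (2 * n + 1 : ℝ) ^ d)
      ((pairCorr d n δ η + 1 / (2 * n + 1 : ℝ) ^ d) / 4) η := by
  have hcard : (Fintype.card (box d n) : ℝ) = (2 * n + 1 : ℝ) ^ d := by
    rw [Fintype.card_coe, card_box]; push_cast; rfl
  have : Nonempty (box d n) := ⟨⟨0, mem_box.2 fun i => by simp⟩⟩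
  have h1 := hasDerivAt_freeEnergy_amp (V := box d n) (fun e : Edge d n => e.1) hδ hη
  rw [hcard, ← pairCorr_eq d n hδ] at h1
  refine (h1.sub_const
    (Fintype.card (Edge d n) * Real.log 2 / (2 * n + 1 : ℝ) ^ d)).congr_of_eventuallyEq
    (Eventually.of_forall fun s => ?_)
  simp only [regionEnergy, graphEnergy, sub_div]
  -- The box graph and the graph induced on the box by the lattice agree definitionally, and so do
  -- their edge counts.
  rfl

theorem countable_badSNR {d : ℕ} (hd : 1 ≤ d) {δ : ℝ} (hδ : δ ∈ Set.Icc (0 : ℝ) 1) :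
    (badSNR d δ).Countable := by
  have hδ' : δ ∈ Set.Icc (-1 : ℝ) 1 := ⟨by linarith [hδ.1], hδ.2⟩
  -- This uses `1 ≤ d`; for `d = 0` the diagonal term would stay equal to 1.
  have hz : Tendsto (fun n : ℕ => 1 / (2 * n + 1 : ℝ) ^ d) atTop (𝓝 0) := by
    refine tendsto_const_nhds.div_atTop ((tendsto_pow_atTop (by omega)).comp ?_)
    exact tendsto_atTop_add_const_right _ _
      (tendsto_natCast_atTop_atTop.const_mul_atTop (by norm_num))
  have key := countable_not_tendsto_deriv
    (h := fun n s => regionEnergy δ s (box d n) / (2 * n + 1 : ℝ) ^ d)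
    (φ := fun n s => (pairCorr d n δ s + 1 / (2 * n + 1 : ℝ) ^ d) / 4) (M := 1 / 2)
    (fun n x hx => hasDerivAt_regionEnergy_box d n hδ' hx)
    (fun n x hx y hy hxy => by
      have := pairCorr_mono d n hδ.1 le_rfl hδ.2 (le_of_lt hx) hxy
      simp only
      linarith)
    (fun n x => div_nonneg (add_nonneg (pairCorr_nonneg ..) (by positivity)) (by norm_num))
    (fun n x => by
      have h1 : pairCorr d n δ x ≤ 1 := by
        rw [pairCorr_eq d n hδ']
        exact meanOverlap_le_one _ hδ' _
      have h2 : 1 / (2 * n + 1 : ℝ) ^ d ≤ 1 := by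
        rw [div_le_one (by positivity)]
        exact one_le_pow₀ (by linarith [n.cast_nonneg (α := ℝ)])
      linarith)
    (fun x hx => exists_tendsto_regionEnergy d hδ' hx)
  -- The derivative argument covers `η > 0` only; the point 0 is added by hand.
  refine (key.union (Set.countable_singleton (0 : ℝ))).mono fun η hη => ?_
  rcases hη.1.eq_or_lt with h | h
  · exact Or.inr h.symm
  · refine Or.inl ⟨h, fun ⟨l, hl⟩ => hη.2 ⟨4 * l - 0, ?_⟩⟩
    have := (hl.const_mul 4).sub hz
    refine this.congr fun n => ?_
    ring

end LatticeSync

end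

theorem mainTheorem3 (d : ℕ) (hd : 1 ≤ d) :
    (∀ δ ∈ Set.Icc (0 : ℝ) 1, (LatticeSync.badSNR d δ).Countable) ∧
    ∃ q : ℝ → ℝ → ℝ,
      (∀ δ ∈ Set.Icc (0 : ℝ) 1, ∀ η ∈ Set.Ici (0 : ℝ) \ LatticeSync.badSNR d δ,
        0 ≤ q δ η ∧ Tendsto (fun n => LatticeSync.pairCorr d n δ η) atTop (𝓝 (q δ η ^ 2))) ∧
      (∀ η ∈ Set.Ici (0 : ℝ),
        MonotoneOn (fun δ => q δ η) {δ | δ ∈ Set.Icc (0 : ℝ) 1 ∧ η ∉ LatticeSync.badSNR d δ}) ∧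
      (∀ δ ∈ Set.Icc (0 : ℝ) 1,
        MonotoneOn (fun η => q δ η) (Set.Ici (0 : ℝ) \ LatticeSync.badSNR d δ)) := by
  refine ⟨fun δ hδ => LatticeSync.countable_badSNR hd hδ,
    -- Where the limit does not exist `limUnder` is an arbitrary value, which no claim about `q`
    -- involves.
    fun δ η => √(limUnder atTop fun n => LatticeSync.pairCorr d n δ η), ?_⟩
  have hlim : ∀ δ η : ℝ, 0 ≤ η → η ∉ LatticeSync.badSNR d δ →
      Tendsto (fun n => LatticeSync.pairCorr d n δ η) atTop
        (𝓝 (limUnder atTop fun n => LatticeSync.pairCorr d n δ η)) := fun δ η h0 hη =>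
    tendsto_nhds_limUnder (not_not.1 fun h => hη ⟨h0, h⟩)
  refine ⟨fun δ hδ η hη => ⟨Real.sqrt_nonneg _, ?_⟩, fun η hη δ hδ δ' hδ' h => ?_,
    fun δ hδ η hη η' hη' h => ?_⟩
  · have h := hlim δ η hη.1 hη.2
    rwa [Real.sq_sqrt (ge_of_tendsto' h fun n => LatticeSync.pairCorr_nonneg d n δ η)]
  · exact Real.sqrt_le_sqrt (le_of_tendsto_of_tendsto' (hlim δ η hη hδ.2) (hlim δ' η hη hδ'.2)
      fun n => LatticeSync.pairCorr_mono d n hδ.1.1 h hδ'.1.2 hη le_rfl)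
  · exact Real.sqrt_le_sqrt (le_of_tendsto_of_tendsto' (hlim δ η hη.1 hη.2) (hlim δ η' hη'.1 hη'.2)
      fun n => LatticeSync.pairCorr_mono d n hδ.1 le_rfl hδ.2 hη.1 h)
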